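/- Let $n\ge 1$, $1<p<\infty$ and $0<\varepsilon<1$. There is a constant $C=C(n,p,\varepsilon)>0$ with the following property. Let $0<s<1$, let $\emptyset\ne G\subset\mathbb R^n$ be open, and let $R:G\to\mathbb R$ be a measurable function with $0\le R(x)\le \operatorname{dist}(x,\partial G)$ for every $x\in G$, where $\operatorname{dist}(x,\emptyset)=\infty$. For $f\in L^p(G)$ (real-valued) and $x\in G$ put $$M_R(f)(x)=\sup_{0\le r\le R(x)}\ \frac1{|B(x,r)|}\int_{B(x,r)}|f(y)|\,dy,$$ where $B(x,r)$ is the open ball and the average is understood to be $|f(x)|$ when $r=0$. Then, for every $f\in L^p(G)$, the function $M_R(f)$ is measurable and finite almost everywhere on $G$, and $$\int_G\int_G\frac{|M_R(f)(x)-M_R(f)(y)|^p}{(|x-y|+|R(x)-R(y)|)^{\varepsilon+sp}}\,\frac{dy\,dx}{|x-y|^{n-\varepsilon}}\le C\,|f|_{W^{s,p}(G)}^p,$$ where $$|f|_{W^{s,p}(G)}=\left(\int_G\int_G\frac{|f(x)-f(y)|^p}{|x-y|^{n+sp}}\,dy\,dx\right)^{1/p}\in[0,\infty].$$ In particular $C$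 does not depend on $s$, $G$, $R$ or $f$. -/

import Mathlib

open MeasureTheory
open scoped ENNReal

noncomputable section

/-- The integral average of `|f|` over the open ball `B(x,r)` with respect to Lebesgue measure,
with the convention that the average over a ball of radius `0` is `|f(x)|`. -/
def ballAverage {n : ℕ} (f : EuclideanSpace ℝ (Fin n) → ℝ) (x : EuclideanSpace ℝ (Fin n))
    (r : ℝ) : ℝ≥0∞ :=
  if r = 0 then ‖f x‖ₑ else ⨍⁻ y, ‖f y‖ₑ ∂(volume.restrict (Metric.ball x r))

/-- The maximal function `M_R(f)(x)`: the supremum, in `[0,∞]`, of the averages of `|f|` over the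
balls `B(x,r)` with `0 ≤ r ≤ R(x)`. -/
def maximalR {n : ℕ} (R f : EuclideanSpace ℝ (Fin n) → ℝ) (x : EuclideanSpace ℝ (Fin n)) : ℝ≥0∞ :=
  ⨆ (r : ℝ) (_ : 0 ≤ r ∧ r ≤ R x), ballAverage f x r

/-- `R` is a Lebesgue measurable function on `G` with `0 ≤ R(x) ≤ dist(x, ∂G)` for every `x ∈ G`.
The distance takes values in `[0,∞]`, and the distance to the empty set is `∞`. Only the values of
`R` on `G` matter. (For Lebesgue measure, `AEMeasurable` is the same as Lebesgue measurable.) -/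
structure IsAdmissibleRadius {n : ℕ} (G : Set (EuclideanSpace ℝ (Fin n)))
    (R : EuclideanSpace ℝ (Fin n) → ℝ) : Prop where
  measurable : AEMeasurable R (volume.restrict G)
  nonneg : ∀ x ∈ G, 0 ≤ R x
  le_dist : ∀ x ∈ G, ENNReal.ofReal (R x) ≤ Metric.infEDist x (frontier G)

/-- The fractional Sobolev seminorm `|f|_{W^{s,p}(G)}`, with values in `[0,∞]`. -/
def fracSobolevSeminorm {n : ℕ} (s p : ℝ) (G : Set (EuclideanSpace ℝ (Fin n)))
    (f : EuclideanSpace ℝ (Fin n) → ℝ) : ℝ≥0∞ :=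
  (∫⁻ x in G, ∫⁻ y in G, ‖f x - f y‖ₑ ^ p / ‖x - y‖ₑ ^ ((n : ℝ) + s * p)) ^ (1 / p)

end

open Metric Set

/-! Put `θ = s * p` and `ρ = |x - y| + |R x - R y|`. Each average of `|f|` over `B(x,r)` with `r ≤ R
x` is compared with the average over `B(y,r')`, where `r' = max 0 (r - ρ)`; this radius is
admissible because `r - ρ ≤ R y`. By symmetry, one-sided comparisons suffice.

The error has three sources. If `r = 0`, or if `r ≤ ρ` and `r ≤ |x - y|`, it is controlled by the
difference quotient `Q` of order `(n + θ) / p`, or by the maximal function of `Q(y,·)` at `x`. If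
`|x - y| ≤ r ≤ ρ`, it is controlled by the mean oscillation of `f` around `y` at a scale `2 ^ k`
comparable to `r`. If `r > ρ`, both balls are parametrized by the unit ball; corresponding points
are joined through a ball of radius `ρ` inside `G`, which gives maximal functions of the oscillation
at scale `2 ^ k` comparable to `ρ` (`laverage_ball_le_laverage_ball_add`).

In the last two cases `|x - y| ≤ 2 ^ k ≤ 2ρ`, so the weight `ρ ^ (ε + θ) * |x - y| ^ (n - ε)` can be
traded for one term of a sum over all `k` (`le_scaleMajorant`), in which `R` no longer appears.
Integrating `|x - y| ^ (ε - n)` over `|x - y| ≤ 2 ^ k` gives a multiple of `2 ^ (kε)`, and the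
Hardy–Littlewood theorem removes the maximal functions. What remains is the sum over `k` of `2 ^
(-kθ)` times the `p`-th power integral of the oscillation, which Jensen and a geometric series bound
by the seminorm (`tsum_lintegral_localOscillation_le`).

The only series whose ratio involves `s` has ratio `2 ^ (-(n + θ))`, so the constant stays bounded
as `s` tends to `0`. -/

/-! ### Geometric series over dyadic scales. -/

theorem ENNReal.two_zpow_ne_zero (k : ℤ) : (2 : ℝ≥0∞) ^ k ≠ 0 :=
  (ENNReal.zpow_pos two_ne_zero ENNReal.ofNat_ne_top k).ne'

theorem ENNReal.two_zpow_ne_top (k : ℤ) : (2 : ℝ≥0∞) ^ k ≠ ∞ :=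
  (ENNReal.zpow_lt_top two_ne_zero ENNReal.ofNat_ne_top k).ne

theorem ENNReal.ofReal_two_zpow (k : ℤ) : ENNReal.ofReal ((2 : ℝ) ^ k) = 2 ^ k := by
  rw [← Real.rpow_intCast, ← ENNReal.ofReal_rpow_of_pos two_pos, ENNReal.ofReal_ofNat,
    ENNReal.rpow_intCast]

/-- The sum of the geometric series with ratio `2 ^ (-β)`. -/
noncomputable def dyadicConst (β : ℝ) : ℝ≥0∞ := (1 - 2 ^ (-β))⁻¹

theorem dyadicConst_ne_zero (β : ℝ) : dyadicConst β ≠ 0 := by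
  unfold dyadicConst
  exact ENNReal.inv_ne_zero.2 (ne_top_of_le_ne_top ENNReal.one_ne_top tsub_le_self)

theorem dyadicConst_ne_top {β : ℝ} (hβ : 0 < β) : dyadicConst β ≠ ∞ := by
  unfold dyadicConst
  rw [Ne, ENNReal.inv_eq_top, tsub_eq_zero_iff_le, not_le]
  exact ENNReal.rpow_lt_one_of_one_lt_of_neg (by norm_num) (by linarith)

/-- Applied with `β = finrank ℝ E + θ`, this is what makes the final constant independent of `s`. -/
theorem dyadicConst_le_two {β : ℝ} (hβ : 1 ≤ β) : dyadicConst β ≤ 2 := by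
  unfold dyadicConst
  rw [ENNReal.inv_le_iff_inv_le]
  have : (2 : ℝ≥0∞) ^ (-β) ≤ 2⁻¹ := by
    rw [← ENNReal.rpow_neg_one]
    exact ENNReal.rpow_le_rpow_of_exponent_le (by norm_num) (by linarith)
  calc (2 : ℝ≥0∞)⁻¹ = 1 - 2⁻¹ := ENNReal.one_sub_inv_two.symm
    _ ≤ _ := tsub_le_tsub_left this _

/-- A geometric series over the dyadic scales below `a`. -/
theorem tsum_dyadic_le {β : ℝ} (hβ : 0 < β) (a : ℝ≥0∞) :
    ∑' k : ℤ, (if (2 : ℝ≥0∞) ^ k ≤ a then ((2 : ℝ≥0∞) ^ k) ^ β else 0) ≤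
      dyadicConst β * a ^ β := by
  rcases eq_or_ne a 0 with rfl | ha0
  · simp [ENNReal.two_zpow_ne_zero]
  rcases eq_or_ne a ∞ with rfl | hat
  · rw [ENNReal.top_rpow_of_pos hβ, ENNReal.mul_top (dyadicConst_ne_zero β)]
    exact le_top
  obtain ⟨m, hm⟩ := ENNReal.exists_mem_Ico_zpow ha0 hat ENNReal.one_lt_two ENNReal.ofNat_ne_top
  have key : ∀ k : ℤ, (if (2 : ℝ≥0∞) ^ k ≤ a then ((2 : ℝ≥0∞) ^ k) ^ β else 0) ≤
      (if k ≤ m then ((2 : ℝ≥0∞) ^ k) ^ β else 0) := by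
    intro k
    split_ifs with h1 h2
    · exact le_rfl
    · exfalso
      have : (2 : ℝ≥0∞) ^ (m + 1) ≤ 2 ^ k :=
        ENNReal.zpow_le_of_le one_le_two (by omega)
      exact absurd (this.trans h1) (not_le.2 hm.2)
    · exact zero_le
    · exact le_rfl
  have hinj : Function.Injective fun i : ℕ => m - (i : ℤ) := fun i j h => by
    simpa using h
  calc _ ≤ ∑' k : ℤ, (if k ≤ m then ((2 : ℝ≥0∞) ^ k) ^ β else 0) := ENNReal.tsum_le_tsum key
    _ = ∑' i : ℕ, (if m - (i : ℤ) ≤ m then ((2 : ℝ≥0∞) ^ (m - (i : ℤ))) ^ β else 0) := by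
        refine (hinj.tsum_eq ?_).symm
        intro k hk
        have hk' : k ≤ m := by
          by_contra h
          simp [h] at hk
        exact ⟨(m - k).toNat, by simp [hk']⟩
    _ = ∑' i : ℕ, ((2 : ℝ≥0∞) ^ m) ^ β * ((2 : ℝ≥0∞) ^ (-β)) ^ i := by
        refine tsum_congr fun i => ?_
        rw [if_pos (by omega), sub_eq_add_neg,
          ENNReal.zpow_add two_ne_zero ENNReal.ofNat_ne_top,
          ENNReal.mul_rpow_of_nonneg _ _ hβ.le, ← ENNReal.rpow_intCast 2 (-(i : ℤ)),
          ← ENNReal.rpow_mul, ← ENNReal.rpow_natCast, ← ENNReal.rpow_mul]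
        push_cast
        ring_nf
    _ = dyadicConst β * ((2 : ℝ≥0∞) ^ m) ^ β := by
        rw [ENNReal.tsum_mul_left, ENNReal.tsum_geometric, mul_comm, dyadicConst]
    _ ≤ _ := by gcongr; exact hm.1

/-- A geometric series over the dyadic scales above `a`. -/
theorem tsum_dyadic_ge {β : ℝ} (hβ : 0 < β) (a : ℝ≥0∞) :
    ∑' k : ℤ, (if a ≤ (2 : ℝ≥0∞) ^ k then ((2 : ℝ≥0∞) ^ k) ^ (-β) else 0) ≤
      dyadicConst β * a ^ (-β) := by
  -- The substitutions `k ↦ -k` and `a ↦ a⁻¹` exchange the scales above `a` with those below.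
  have := tsum_dyadic_le hβ a⁻¹
  rw [← (Equiv.neg ℤ).tsum_eq, ENNReal.inv_rpow, ← ENNReal.rpow_neg] at this
  convert this using 4 with k
  · simp [ENNReal.zpow_neg]
  · simp only [Equiv.neg_apply, ENNReal.zpow_neg]
    rw [ENNReal.inv_rpow, ← ENNReal.rpow_neg]

/-- The powers of `a` are controlled by the dyadic scales below `a`. -/
theorem rpow_le_tsum_dyadic {β : ℝ} (hβ : 0 < β) (a : ℝ≥0∞) :
    a ^ β ≤ 2 ^ β * ∑' k : ℤ, (if (2 : ℝ≥0∞) ^ k < a then ((2 : ℝ≥0∞) ^ k) ^ β else 0) := by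
  -- A single term suffices: the largest dyadic scale below a finite positive `a` is within a factor
  -- `2` of it. For `a = ∞` the terms are unbounded.
  have step : ∀ m : ℤ, (2 : ℝ≥0∞) ^ m < a → (2 ^ (m + 1)) ^ β ≤
      2 ^ β * ∑' k : ℤ, (if (2 : ℝ≥0∞) ^ k < a then ((2 : ℝ≥0∞) ^ k) ^ β else 0) := by
    intro m hm
    rw [ENNReal.zpow_add two_ne_zero ENNReal.ofNat_ne_top, zpow_one,
      ENNReal.mul_rpow_of_nonneg _ _ hβ.le, mul_comm]
    gcongr
    refine le_trans ?_ (ENNReal.le_tsum m)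
    rw [if_pos hm]
  rcases eq_or_ne a 0 with rfl | ha0
  · simp [ENNReal.zero_rpow_of_pos hβ]
  rcases eq_or_ne a ∞ with rfl | hat
  · refine le_of_forall_lt fun c hc => ?_
    obtain ⟨j, hj⟩ := ENNReal.exists_nat_gt (ENNReal.rpow_lt_top_of_nonneg
      (inv_nonneg.2 hβ.le) (hc.trans_le le_top).ne).ne
    refine lt_of_lt_of_le ?_ (step j (ENNReal.two_zpow_ne_top j).lt_top)
    rw [← ENNReal.rpow_inv_lt_iff hβ]
    refine hj.trans_le ?_
    calc (j : ℝ≥0∞) ≤ (2 : ℝ≥0∞) ^ j := by exact_mod_cast j.lt_two_pow_self.le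
      _ = (2 : ℝ≥0∞) ^ (j : ℤ) := (zpow_natCast _ _).symm
      _ ≤ _ := ENNReal.zpow_le_of_le one_le_two (by omega)
  · obtain ⟨m, hm⟩ := ENNReal.exists_mem_Ioc_zpow ha0 hat ENNReal.one_lt_two ENNReal.ofNat_ne_top
    exact (ENNReal.rpow_le_rpow hm.2 hβ.le).trans (step m hm.1)

/-! ### The Hardy–Littlewood maximal theorem for dyadic radii. -/

section Maximal

set_option linter.unusedSectionVars false

variable {E : Type*} [NormedAddCommGroup E] [NormedSpace ℝ E] [FiniteDimensional ℝ E]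
  [MeasurableSpace E] [BorelSpace E] (μ : Measure E) [μ.IsAddHaarMeasure]

open Module

/-- The Hardy–Littlewood maximal function over the closed balls of dyadic radius. The averages
are normalized by `r ^ dim E` in place of the measure of the ball. -/
noncomputable def dyadicMaximal (g : E → ℝ≥0∞) (x : E) : ℝ≥0∞ :=
  ⨆ k : ℤ, ((2 : ℝ≥0∞) ^ k) ^ (-(finrank ℝ E : ℝ)) * ∫⁻ y in closedBall x (2 ^ k), g y ∂μ

/-- The parameter allows the maximal function to act on one variable of the difference quotient
while Tonelli is applied to both. -/
theorem measurable_lintegral_closedBall_prod {α : Type*} [MeasurableSpace α]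
    {F : α → E → ℝ≥0∞} (hF : Measurable (Function.uncurry F)) (r : ℝ) :
    Measurable fun q : α × E => ∫⁻ y in closedBall q.2 r, F q.1 y ∂μ := by
  simp_rw [← lintegral_indicator measurableSet_closedBall]
  refine Measurable.lintegral_prod_right' (f := fun z : (α × E) × E =>
    (closedBall z.1.2 r).indicator (F z.1.1) z.2) ?_
  have hs : MeasurableSet {z : (α × E) × E | dist z.2 z.1.2 ≤ r} :=
    measurableSet_le (by fun_prop) measurable_const
  have : Measurable fun z : (α × E) × E => F z.1.1 z.2 :=
    hF.comp (f := fun z : (α × E) × E => (z.1.1, z.2)) (by fun_prop)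
  exact this.indicator hs

theorem measurable_dyadicMaximal_prod {α : Type*} [MeasurableSpace α]
    {F : α → E → ℝ≥0∞} (hF : Measurable (Function.uncurry F)) :
    Measurable fun q : α × E => dyadicMaximal μ (F q.1) q.2 := by
  unfold dyadicMaximal
  exact Measurable.iSup fun k =>
    (measurable_lintegral_closedBall_prod μ hF _).const_mul _

theorem measurable_dyadicMaximal {g : E → ℝ≥0∞} (hg : Measurable g) :
    Measurable (dyadicMaximal μ g) := by
  have hF : Measurable (Function.uncurry fun _ : Unit => g) := by
    rw [Function.uncurry_def]
    fun_prop
  have h : Measurable fun q : Unit × E => dyadicMaximal μ g q.2 :=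
    measurable_dyadicMaximal_prod μ hF
  have h' : Measurable fun x : E => ((), x) := measurable_const.prodMk measurable_id
  simpa only [Function.comp_def] using h.comp h'

/-- Integrals over balls are controlled by the maximal function. -/
theorem lintegral_ball_le_dyadicMaximal (g : E → ℝ≥0∞) (x : E) {r : ℝ} (hr : 0 < r) :
    ∫⁻ y in ball x r, g y ∂μ ≤
      2 ^ (finrank ℝ E : ℝ) * ENNReal.ofReal r ^ (finrank ℝ E : ℝ) * dyadicMaximal μ g x := by
  obtain ⟨m, hm1, hm2⟩ := exists_mem_Ioc_zpow hr one_lt_two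
  set d : ℝ := (finrank ℝ E : ℝ)
  have hd : 0 ≤ d := Nat.cast_nonneg _
  have h2 := ENNReal.two_zpow_ne_zero (m + 1)
  have h2' := ENNReal.two_zpow_ne_top (m + 1)
  have hle : ∫⁻ y in ball x r, g y ∂μ ≤ ∫⁻ y in closedBall x (2 ^ (m + 1)), g y ∂μ :=
    lintegral_mono_set ((ball_subset_ball hm2).trans ball_subset_closedBall)
  have hM : ((2 : ℝ≥0∞) ^ (m + 1)) ^ (-d) * ∫⁻ y in closedBall x (2 ^ (m + 1)), g y ∂μ ≤
      dyadicMaximal μ g x :=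
    le_iSup (fun k : ℤ => ((2 : ℝ≥0∞) ^ k) ^ (-d) *
      ∫⁻ y in closedBall x (2 ^ k), g y ∂μ) (m + 1)
  calc _ ≤ ((2 : ℝ≥0∞) ^ (m + 1)) ^ d * (((2 : ℝ≥0∞) ^ (m + 1)) ^ (-d) *
        ∫⁻ y in closedBall x (2 ^ (m + 1)), g y ∂μ) := by
        rw [← mul_assoc, ← ENNReal.rpow_add _ _ h2 h2', add_neg_cancel, ENNReal.rpow_zero,
          one_mul]
        exact hle
    _ ≤ ((2 : ℝ≥0∞) ^ (m + 1)) ^ d * dyadicMaximal μ g x := by gcongr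
    _ ≤ _ := by
        gcongr
        rw [← ENNReal.mul_rpow_of_nonneg _ _ hd, zpow_add₀ two_ne_zero] at *
        gcongr
        rw [ENNReal.zpow_add two_ne_zero ENNReal.ofNat_ne_top, zpow_one, mul_comm,
          ← ENNReal.ofReal_two_zpow]
        gcongr

theorem addHaar_closedBall_rpow (x : E) {r : ℝ} (hr : 0 < r) :
    μ (closedBall x r) = ENNReal.ofReal r ^ (finrank ℝ E : ℝ) * μ (ball 0 1) := by
  rw [Measure.addHaar_closedBall _ _ hr.le, ENNReal.rpow_natCast, ENNReal.ofReal_pow hr.le]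

theorem addHaar_ball_rpow (x : E) {r : ℝ} (hr : 0 < r) :
    μ (ball x r) = ENNReal.ofReal r ^ (finrank ℝ E : ℝ) * μ (ball 0 1) := by
  rw [Measure.addHaar_ball_of_pos _ _ hr, ENNReal.rpow_natCast, ENNReal.ofReal_pow hr.le]

/-- The weak type `(1,1)` estimate. -/
theorem mul_measure_lt_dyadicMaximal_le (g : E → ℝ≥0∞) (t : ℝ≥0∞) :
    t * μ {x | t < dyadicMaximal μ g x} ≤
      5 ^ (finrank ℝ E : ℝ) * μ (ball 0 1) * ∫⁻ x, g x ∂μ := by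
  set d : ℝ := (finrank ℝ E : ℝ) with hd
  have hd0 : 0 ≤ d := Nat.cast_nonneg _
  -- The Vitali covering lemma needs bounded radii, so the level set is exhausted by the points
  -- whose witnessing radius is at most `2 ^ N`.
  let S : ℕ → Set E := fun N => {x | ∃ k : ℤ, k ≤ N ∧
    t < ((2 : ℝ≥0∞) ^ k) ^ (-d) * ∫⁻ y in closedBall x (2 ^ k), g y ∂μ}
  have hS : {x | t < dyadicMaximal μ g x} = ⋃ N, S N := by
    ext x
    simp only [dyadicMaximal, lt_iSup_iff, mem_ofPred_eq, mem_iUnion, S]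
    exact ⟨fun ⟨k, hk⟩ => ⟨k.toNat, k, Int.self_le_toNat k, hk⟩, fun ⟨_, k, _, hk⟩ => ⟨k, hk⟩⟩
  have hmono : Monotone S := fun M N h x ⟨k, hk, hk'⟩ => ⟨k, hk.trans (by exact_mod_cast h), hk'⟩
  rw [hS, hmono.measure_iUnion, ENNReal.mul_iSup]
  refine iSup_le fun N => ?_
  have hch : ∀ x : E, ∃ k : ℤ, x ∈ S N → k ≤ N ∧
      t < ((2 : ℝ≥0∞) ^ k) ^ (-d) * ∫⁻ y in closedBall x (2 ^ k), g y ∂μ := fun x => by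
    by_cases hx : x ∈ S N
    · obtain ⟨k, hk⟩ := hx
      exact ⟨k, fun _ => hk⟩
    · exact ⟨0, fun h => absurd h hx⟩
  choose k hk using hch
  -- Disjoint balls whose enlargements by `5` cover `S N`; this is the origin of `5 ^ d`.
  obtain ⟨u, huS, hdisj, hcov⟩ := Vitali.exists_disjoint_subfamily_covering_enlargement_closedBall
    (S N) (fun x => x) (fun x => (2 : ℝ) ^ k x) (2 ^ (N : ℤ))
    (fun x hx => zpow_le_zpow_right₀ one_le_two (hk x hx).1) 5 (by norm_num)
  have hu : u.Countable := hdisj.countable_of_nonempty_interior fun x _ =>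
    ⟨x, ball_subset_interior_closedBall (mem_ball_self (by positivity))⟩
  have hsub : S N ⊆ ⋃ x ∈ u, closedBall x (5 * 2 ^ k x) := fun x hx => by
    obtain ⟨b, hb, hxb⟩ := hcov x hx
    exact mem_iUnion₂.2 ⟨b, hb, hxb (mem_closedBall_self (by positivity))⟩
  have hball : ∀ x ∈ u, t * μ (closedBall x (5 * 2 ^ k x)) ≤
      5 ^ d * μ (ball 0 1) * ∫⁻ y in closedBall x (2 ^ k x), g y ∂μ := by
    intro x hx
    have h0 := ENNReal.two_zpow_ne_zero (k x)
    have h1 := ENNReal.two_zpow_ne_top (k x)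
    rw [addHaar_closedBall_rpow μ x (by positivity), ENNReal.ofReal_mul (by norm_num),
      ENNReal.ofReal_two_zpow, ENNReal.mul_rpow_of_nonneg _ _ hd0, ENNReal.ofReal_ofNat]
    calc t * (5 ^ d * (2 ^ k x) ^ d * μ (ball 0 1))
        ≤ (((2 : ℝ≥0∞) ^ k x) ^ (-d) * ∫⁻ y in closedBall x (2 ^ k x), g y ∂μ) *
          (5 ^ d * (2 ^ k x) ^ d * μ (ball 0 1)) := by
          gcongr
          exact (hk x (huS hx)).2.le
      _ = (((2 : ℝ≥0∞) ^ k x) ^ (-d) * (2 ^ k x) ^ d) * (5 ^ d * μ (ball 0 1) *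
          ∫⁻ y in closedBall x (2 ^ k x), g y ∂μ) := by ring
      _ = _ := by
          rw [← ENNReal.rpow_add _ _ h0 h1, neg_add_cancel, ENNReal.rpow_zero, one_mul]
  have := hu.to_subtype
  calc t * μ (S N) ≤ t * ∑' x : u, μ (closedBall (x : E) (5 * 2 ^ k x)) := by
        gcongr
        exact (measure_mono hsub).trans (measure_biUnion_le μ hu _)
    _ = ∑' x : u, t * μ (closedBall (x : E) (5 * 2 ^ k x)) := ENNReal.tsum_mul_left.symm
    _ ≤ ∑' x : u, 5 ^ d * μ (ball 0 1) * ∫⁻ y in closedBall (x : E) (2 ^ k x), g y ∂μ :=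
        ENNReal.tsum_le_tsum fun x => hball x x.2
    _ = 5 ^ d * μ (ball 0 1) * ∫⁻ y in ⋃ x ∈ u, closedBall x (2 ^ k x), g y ∂μ := by
        rw [ENNReal.tsum_mul_left, lintegral_biUnion hu
          (fun x _ => measurableSet_closedBall) hdisj]
    _ ≤ _ := by
        gcongr
        exact Measure.restrict_le_self

/-- The truncation step in the interpolation between weak `(1,1)` and `L^∞`. -/
theorem dyadicMaximal_le_indicator_add (g : E → ℝ≥0∞) (t : ℝ≥0∞) (x : E) :
    dyadicMaximal μ g x ≤
      dyadicMaximal μ ({y | t < g y}.indicator g) x + t * μ (ball 0 1) := by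
  refine iSup_le fun k => ?_
  set d : ℝ := (finrank ℝ E : ℝ)
  have h0 := ENNReal.two_zpow_ne_zero k
  have h1 := ENNReal.two_zpow_ne_top k
  have hle : ∫⁻ y in closedBall x (2 ^ k), g y ∂μ ≤
      (∫⁻ y in closedBall x (2 ^ k), {y | t < g y}.indicator g y ∂μ) +
        t * ((2 ^ k) ^ d * μ (ball 0 1)) := by
    rw [← ENNReal.ofReal_two_zpow, ← addHaar_closedBall_rpow μ x (by positivity),
      ← setLIntegral_const, ← lintegral_add_right _ measurable_const]
    refine lintegral_mono fun y => ?_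
    by_cases hy : t < g y
    · simp [indicator, hy]
    · simpa [indicator, hy] using not_lt.1 hy
  calc _ ≤ ((2 : ℝ≥0∞) ^ k) ^ (-d) *
        ((∫⁻ y in closedBall x (2 ^ k), {y | t < g y}.indicator g y ∂μ) +
        t * ((2 ^ k) ^ d * μ (ball 0 1))) := by gcongr
    _ = ((2 : ℝ≥0∞) ^ k) ^ (-d) *
        (∫⁻ y in closedBall x (2 ^ k), {y | t < g y}.indicator g y ∂μ) +
        (((2 : ℝ≥0∞) ^ k) ^ (-d) * (2 ^ k) ^ d) * (t * μ (ball 0 1)) := by ring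
    _ ≤ _ := by
        rw [← ENNReal.rpow_add _ _ h0 h1, neg_add_cancel, ENNReal.rpow_zero, one_mul]
        gcongr
        exact le_iSup (fun k : ℤ => ((2 : ℝ≥0∞) ^ k) ^ (-d) *
          ∫⁻ y in closedBall x (2 ^ k), {y | t < g y}.indicator g y ∂μ) k

/-- The constant of the Hardy–Littlewood maximal theorem on `L^p`. -/
noncomputable def maximalConst (p : ℝ) : ℝ≥0∞ :=
  (2 * μ (ball (0 : E) 1)) ^ p * (2 ^ p * (5 ^ (finrank ℝ E : ℝ) * dyadicConst (p - 1)))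

theorem maximalConst_ne_top {p : ℝ} (hp : 1 < p) : maximalConst μ p ≠ ∞ := by
  have hω : μ (ball (0 : E) 1) ≠ ∞ := measure_ball_lt_top.ne
  have hd : (0 : ℝ) ≤ finrank ℝ E := Nat.cast_nonneg _
  have hp0 : 0 ≤ p := by linarith
  exact ENNReal.mul_ne_top
    (ENNReal.rpow_ne_top_of_nonneg hp0 (ENNReal.mul_ne_top ENNReal.ofNat_ne_top hω))
    (ENNReal.mul_ne_top (ENNReal.rpow_ne_top_of_nonneg hp0 ENNReal.ofNat_ne_top)
      (ENNReal.mul_ne_top (ENNReal.rpow_ne_top_of_nonneg hd ENNReal.ofNat_ne_top)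
        (dyadicConst_ne_top (by linarith))))

/-- The Hardy–Littlewood maximal theorem on `L^p`, `1 < p < ∞`. -/
theorem lintegral_dyadicMaximal_rpow_le {p : ℝ} (hp : 1 < p) {g : E → ℝ≥0∞} (hg : Measurable g) :
    ∫⁻ x, dyadicMaximal μ g x ^ p ∂μ ≤ maximalConst μ p * ∫⁻ x, g x ^ p ∂μ := by
  unfold maximalConst
  have hω0 : μ (ball (0 : E) 1) ≠ 0 := (measure_ball_pos μ 0 one_pos).ne'
  have hωt : μ (ball (0 : E) 1) ≠ ∞ := measure_ball_lt_top.ne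
  set ω := μ (ball (0 : E) 1)
  set d : ℝ := (finrank ℝ E : ℝ)
  have hp0 : 0 < p := by linarith
  have h2ω0 : 2 * ω ≠ 0 := mul_ne_zero two_ne_zero hω0
  have h2ωt : 2 * ω ≠ ∞ := ENNReal.mul_ne_top ENNReal.ofNat_ne_top hωt
  have hM := measurable_dyadicMaximal μ hg
  -- Marcinkiewicz truncation at height `t = 2 ^ j`: the part of `g` below `t` contributes at most
  -- `t * ω` to the maximal function. Where this exceeds `2 * ω * t`, the part above `t` must
  -- therefore contribute more than `t * ω`, and the weak type estimate applies to that part.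
  have hlevel : ∀ j : ℤ, ((2 : ℝ≥0∞) ^ j) ^ p *
      μ {x | (2 : ℝ≥0∞) ^ j < (2 * ω)⁻¹ * dyadicMaximal μ g x} ≤
      5 ^ d * ∫⁻ x, (if (2 : ℝ≥0∞) ^ j ≤ g x then ((2 : ℝ≥0∞) ^ j) ^ (p - 1) else 0) * g x ∂μ := by
    intro j
    have h0 := ENNReal.two_zpow_ne_zero j
    have h1 := ENNReal.two_zpow_ne_top j
    set t := (2 : ℝ≥0∞) ^ j
    set h := {y | t < g y}.indicator g
    have hsub : {x | t < (2 * ω)⁻¹ * dyadicMaximal μ g x} ⊆ {x | t * ω < dyadicMaximal μ h x} := by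
      intro x (hx : t < (2 * ω)⁻¹ * dyadicMaximal μ g x)
      change t * ω < dyadicMaximal μ h x
      by_contra! hle
      refine absurd hx (not_lt.2 ?_)
      calc (2 * ω)⁻¹ * dyadicMaximal μ g x ≤ (2 * ω)⁻¹ * (t * ω + t * ω) := by
            gcongr
            exact (dyadicMaximal_le_indicator_add μ g t x).trans (by gcongr)
        _ = ((2 * ω)⁻¹ * (2 * ω)) * t := by ring
        _ = t := by rw [ENNReal.inv_mul_cancel h2ω0 h2ωt, one_mul]
    have hweak : t * μ {x | t < (2 * ω)⁻¹ * dyadicMaximal μ g x} ≤ 5 ^ d * ∫⁻ x, h x ∂μ := by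
      rw [← ENNReal.mul_le_mul_iff_right hω0 hωt]
      calc ω * (t * μ {x | t < (2 * ω)⁻¹ * dyadicMaximal μ g x})
          ≤ t * ω * μ {x | t * ω < dyadicMaximal μ h x} := by
            rw [← mul_assoc, mul_comm ω]
            gcongr
        _ ≤ 5 ^ d * ω * ∫⁻ x, h x ∂μ := mul_measure_lt_dyadicMaximal_le μ h _
        _ = _ := by ring
    have hpow : t ^ p = t ^ (p - 1) * t := by
      conv_rhs => rw [← ENNReal.rpow_one t, ← ENNReal.rpow_mul, ← ENNReal.rpow_add _ _ h0 h1]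
      ring_nf
    calc t ^ p * μ {x | t < (2 * ω)⁻¹ * dyadicMaximal μ g x}
        = t ^ (p - 1) * (t * μ {x | t < (2 * ω)⁻¹ * dyadicMaximal μ g x}) := by
          rw [hpow, mul_assoc]
      _ ≤ t ^ (p - 1) * (5 ^ d * ∫⁻ x, h x ∂μ) := by gcongr
      _ = 5 ^ d * ∫⁻ x, t ^ (p - 1) * h x ∂μ := by
          rw [lintegral_const_mul' _ _ (ENNReal.rpow_ne_top_of_ne_zero h0 h1)]
          ring
      _ ≤ _ := by
          refine mul_le_mul_right (lintegral_mono fun x => ?_) _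
          by_cases hx : t < g x
          · simp [h, hx, hx.le]
          · simp [h, hx]
  have hmeas : ∀ j : ℤ, Measurable fun x =>
      (if (2 : ℝ≥0∞) ^ j ≤ g x then ((2 : ℝ≥0∞) ^ j) ^ (p - 1) else 0) * g x := fun j =>
    (Measurable.ite (measurableSet_le measurable_const hg) measurable_const
      measurable_const).mul hg
  have hscaled : ∫⁻ x, ((2 * ω)⁻¹ * dyadicMaximal μ g x) ^ p ∂μ ≤
      2 ^ p * (5 ^ d * dyadicConst (p - 1)) * ∫⁻ x, g x ^ p ∂μ := by
    have hset : ∀ j : ℤ, MeasurableSet {x | (2 : ℝ≥0∞) ^ j < (2 * ω)⁻¹ * dyadicMaximal μ g x} :=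
      fun j => measurableSet_lt measurable_const (hM.const_mul _)
    -- A discrete layer-cake formula. After exchanging sum and integral, the heights `2 ^ j ≤ g x`
    -- form a geometric series of order `p - 1`, which is where `p > 1` matters.
    calc ∫⁻ x, ((2 * ω)⁻¹ * dyadicMaximal μ g x) ^ p ∂μ
        ≤ ∫⁻ x, 2 ^ p * ∑' j : ℤ, (if (2 : ℝ≥0∞) ^ j < (2 * ω)⁻¹ * dyadicMaximal μ g x then
            ((2 : ℝ≥0∞) ^ j) ^ p else 0) ∂μ := lintegral_mono fun x => rpow_le_tsum_dyadic hp0 _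
      _ = 2 ^ p * ∑' j : ℤ, ((2 : ℝ≥0∞) ^ j) ^ p *
            μ {x | (2 : ℝ≥0∞) ^ j < (2 * ω)⁻¹ * dyadicMaximal μ g x} := by
          rw [lintegral_const_mul' _ _ (ENNReal.rpow_ne_top_of_nonneg hp0.le ENNReal.ofNat_ne_top),
            lintegral_tsum fun j => (Measurable.ite (hset j) measurable_const
              measurable_const).aemeasurable]
          congr 2 with j
          rw [← lintegral_indicator_const (hset j)]
          simp only [indicator, mem_ofPred_eq]
      _ ≤ 2 ^ p * ∑' j : ℤ, 5 ^ d *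
            ∫⁻ x, (if (2 : ℝ≥0∞) ^ j ≤ g x then ((2 : ℝ≥0∞) ^ j) ^ (p - 1) else 0) * g x ∂μ := by
          exact mul_le_mul_right (ENNReal.tsum_le_tsum hlevel) _
      _ = 2 ^ p * (5 ^ d * ∫⁻ x, (∑' j : ℤ,
            (if (2 : ℝ≥0∞) ^ j ≤ g x then ((2 : ℝ≥0∞) ^ j) ^ (p - 1) else 0)) * g x ∂μ) := by
          rw [ENNReal.tsum_mul_left, ← lintegral_tsum fun j => (hmeas j).aemeasurable]
          simp_rw [ENNReal.tsum_mul_right]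
      _ ≤ 2 ^ p * (5 ^ d * ∫⁻ x, dyadicConst (p - 1) * g x ^ (p - 1) * g x ∂μ) := by
          gcongr with x
          exact tsum_dyadic_le (by linarith) _
      _ = _ := by
          have : ∀ x, dyadicConst (p - 1) * g x ^ (p - 1) * g x = dyadicConst (p - 1) * g x ^ p := by
            intro x
            conv_lhs => rw [mul_assoc]; enter [2, 2]; rw [← ENNReal.rpow_one (g x)]
            rw [← ENNReal.rpow_add_of_nonneg _ _ (by linarith) zero_le_one, sub_add_cancel]
          simp_rw [this]
          rw [lintegral_const_mul' _ _ (dyadicConst_ne_top (by linarith))]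
          ring
  calc ∫⁻ x, dyadicMaximal μ g x ^ p ∂μ
      = (2 * ω) ^ p * ∫⁻ x, ((2 * ω)⁻¹ * dyadicMaximal μ g x) ^ p ∂μ := by
        rw [← lintegral_const_mul' _ _ (ENNReal.rpow_ne_top_of_nonneg hp0.le h2ωt)]
        refine lintegral_congr fun x => ?_
        rw [← ENNReal.mul_rpow_of_nonneg _ _ hp0.le, ← mul_assoc,
          ENNReal.mul_inv_cancel h2ω0 h2ωt, one_mul]
    _ ≤ _ := by
        rw [mul_assoc]
        gcongr

end Maximal

/-! ### Jensen's inequality, the truncated kernel and mean oscillations. -/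

/-- Jensen's inequality for the power function, on a set of arbitrary measure. -/
theorem rpow_setLIntegral_le {α : Type*} [MeasurableSpace α] {μ : Measure α} {p : ℝ} (hp : 1 < p)
    {g : α → ℝ≥0∞} (hg : Measurable g) (s : Set α) :
    (∫⁻ x in s, g x ∂μ) ^ p ≤ μ s ^ (p - 1) * ∫⁻ x in s, g x ^ p ∂μ := by
  have hpq := Real.HolderConjugate.conjExponent hp
  have hp0 : 0 < p := by linarith
  have h := ENNReal.lintegral_mul_le_Lp_mul_Lq (μ.restrict s) hpq hg.aemeasurable
    (aemeasurable_const (b := (1 : ℝ≥0∞)))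
  simp only [Pi.mul_apply, mul_one, ENNReal.one_rpow, lintegral_one,
    Measure.restrict_apply_univ] at h
  calc (∫⁻ x in s, g x ∂μ) ^ p
      ≤ ((∫⁻ x in s, g x ^ p ∂μ) ^ (1 / p) * μ s ^ (1 / p.conjExponent)) ^ p := by gcongr
    _ = _ := by
      rw [ENNReal.mul_rpow_of_nonneg _ _ hp0.le, ← ENNReal.rpow_mul, ← ENNReal.rpow_mul,
        one_div_mul_cancel hp0.ne', ENNReal.rpow_one, mul_comm]
      congr 2
      have : p - 1 ≠ 0 := by linarith
      unfold Real.conjExponent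
      field_simp

theorem ENNReal.rpow_neg_mul_rpow {a : ℝ≥0∞} (h0 : a ≠ 0) (ht : a ≠ ∞) (b : ℝ) :
    a ^ (-b) * a ^ b = 1 := by
  rw [← ENNReal.rpow_add _ _ h0 ht, neg_add_cancel, ENNReal.rpow_zero]

section Oscillation

open Module

set_option linter.unusedSectionVars false

variable {E : Type*} [NormedAddCommGroup E] [NormedSpace ℝ E] [FiniteDimensional ℝ E]
  [MeasurableSpace E] [BorelSpace E] (μ : Measure E) [μ.IsAddHaarMeasure]

theorem mem_closedBall_two_zpow_iff {x y : E} {k : ℤ} :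
    y ∈ closedBall x (2 ^ k) ↔ ‖x - y‖ₑ ≤ 2 ^ k := by
  rw [mem_closedBall', dist_eq_norm, ← ofReal_norm, ← ENNReal.ofReal_two_zpow,
    ENNReal.ofReal_le_ofReal_iff (by positivity)]

theorem addHaar_closedBall_two_zpow (x : E) (k : ℤ) :
    μ (closedBall x (2 ^ k)) = (2 ^ k) ^ (finrank ℝ E : ℝ) * μ (ball 0 1) := by
  rw [addHaar_closedBall_rpow μ x (by positivity), ENNReal.ofReal_two_zpow]

/-- The kernel `|x - y| ^ (-β)`, restricted to distances at most `2 ^ k`. -/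
noncomputable def truncatedKernel (β : ℝ) (k : ℤ) (x y : E) : ℝ≥0∞ :=
  if ‖x - y‖ₑ ≤ 2 ^ k then ‖x - y‖ₑ ^ (-β) else 0

theorem truncatedKernel_comm (β : ℝ) (k : ℤ) (x y : E) :
    truncatedKernel β k x y = truncatedKernel β k y x := by
  unfold truncatedKernel
  rw [← enorm_neg, neg_sub]

theorem measurable_truncatedKernel (β : ℝ) (k : ℤ) :
    Measurable fun q : E × E => truncatedKernel β k q.1 q.2 := by
  have h : Measurable fun q : E × E => ‖q.1 - q.2‖ₑ := by fun_prop
  exact Measurable.ite (measurableSet_le h measurable_const) (h.pow_const _) measurable_const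

/-- A dyadic substitute for polar coordinates: the kernel is dominated by a multiple of the sum over
`j` of `2 ^ (-jβ)` on the ball of radius `2 ^ j`. For `j ≤ k` the terms integrate to multiples of `2
^ (jε)`. For `j ≥ k` only the ball of radius `2 ^ k` counts, and the factors `2 ^ (-jβ)` are summed.
-/
theorem lintegral_truncatedKernel_le {β ε : ℝ} (hβ : 0 < β) (hε : 0 < ε)
    (hβε : β + ε = finrank ℝ E) (k : ℤ) (x : E) :
    ∫⁻ y, truncatedKernel β k x y ∂μ ≤
      2 ^ β * (μ (ball 0 1) * (dyadicConst ε + dyadicConst β)) * (2 ^ k) ^ ε := by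
  set d : ℝ := (finrank ℝ E : ℝ)
  have hd0 : 0 ≤ d := Nat.cast_nonneg _
  set ω := μ (ball (0 : E) 1)
  have hpt : ∀ y, truncatedKernel β k x y ≤ 2 ^ β * ∑' j : ℤ, ((2 : ℝ≥0∞) ^ j) ^ (-β) *
      (closedBall x (2 ^ j) ∩ closedBall x (2 ^ k)).indicator 1 y := by
    intro y
    unfold truncatedKernel
    split_ifs with h
    · rw [ENNReal.rpow_neg, ← ENNReal.inv_rpow]
      refine (rpow_le_tsum_dyadic hβ _).trans ?_
      rw [← (Equiv.neg ℤ).tsum_eq]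
      refine mul_le_mul_right (ENNReal.tsum_le_tsum fun j => ?_) _
      simp only [Equiv.neg_apply, ENNReal.zpow_neg, ENNReal.inv_lt_inv]
      split_ifs with hj
      · have hmem : y ∈ closedBall x ((2 : ℝ) ^ j) ∩ closedBall x (2 ^ k) :=
          ⟨mem_closedBall_two_zpow_iff.2 hj.le, mem_closedBall_two_zpow_iff.2 h⟩
        rw [indicator_of_mem hmem, ENNReal.inv_rpow, ENNReal.rpow_neg]
        simp
      · exact zero_le
    · exact zero_le
  have hvol : ∀ j : ℤ, ((2 : ℝ≥0∞) ^ j) ^ (-β) *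
      μ (closedBall x (2 ^ j) ∩ closedBall x (2 ^ k)) ≤
      ω * ((if (2 : ℝ≥0∞) ^ j ≤ 2 ^ k then ((2 : ℝ≥0∞) ^ j) ^ ε else 0) +
        (2 ^ k) ^ d * (if (2 : ℝ≥0∞) ^ k ≤ 2 ^ j then ((2 : ℝ≥0∞) ^ j) ^ (-β) else 0)) := by
    intro j
    have h0 := ENNReal.two_zpow_ne_zero j
    have h1 := ENNReal.two_zpow_ne_top j
    rcases le_total ((2 : ℝ≥0∞) ^ j) (2 ^ k) with h | h
    · rw [if_pos h]
      calc _ ≤ ((2 : ℝ≥0∞) ^ j) ^ (-β) * ((2 ^ j) ^ d * ω) := by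
            gcongr
            rw [← addHaar_closedBall_two_zpow μ x]
            exact measure_mono inter_subset_left
        _ = ω * (2 ^ j) ^ ε := by
            rw [← mul_assoc, ← ENNReal.rpow_add _ _ h0 h1, mul_comm]
            congr 2
            linarith
        _ ≤ _ := by gcongr; exact le_self_add
    · rw [if_pos h]
      calc _ ≤ ((2 : ℝ≥0∞) ^ j) ^ (-β) * ((2 ^ k) ^ d * ω) := by
            gcongr
            rw [← addHaar_closedBall_two_zpow μ x]
            exact measure_mono inter_subset_right
        _ = ω * ((2 ^ k) ^ d * (2 ^ j) ^ (-β)) := by ring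
        _ ≤ _ := by gcongr; exact le_add_self
  have hms : ∀ j : ℤ, MeasurableSet (closedBall x ((2 : ℝ) ^ j) ∩ closedBall x (2 ^ k)) :=
    fun j => measurableSet_closedBall.inter measurableSet_closedBall
  calc ∫⁻ y, truncatedKernel β k x y ∂μ
      ≤ ∫⁻ y, 2 ^ β * ∑' j : ℤ, ((2 : ℝ≥0∞) ^ j) ^ (-β) *
          (closedBall x (2 ^ j) ∩ closedBall x (2 ^ k)).indicator 1 y ∂μ := lintegral_mono hpt
    _ = 2 ^ β * ∑' j : ℤ, ((2 : ℝ≥0∞) ^ j) ^ (-β) *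
          μ (closedBall x (2 ^ j) ∩ closedBall x (2 ^ k)) := by
        rw [lintegral_const_mul' _ _ (ENNReal.rpow_ne_top_of_nonneg hβ.le ENNReal.ofNat_ne_top),
          lintegral_tsum fun j => (((measurable_one.indicator (hms j)).const_mul _).aemeasurable)]
        congr 2 with j
        rw [lintegral_const_mul _ (measurable_one.indicator (hms j)),
          lintegral_indicator_one (hms j)]
    _ ≤ 2 ^ β * (ω * (dyadicConst ε * (2 ^ k) ^ ε +
          (2 ^ k) ^ d * (dyadicConst β * (2 ^ k) ^ (-β)))) := by
        refine mul_le_mul_right ((ENNReal.tsum_le_tsum hvol).trans ?_) _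
        rw [ENNReal.tsum_mul_left, ENNReal.tsum_add, ENNReal.tsum_mul_left]
        gcongr
        · exact tsum_dyadic_le hε _
        · exact tsum_dyadic_ge hβ _
    _ = 2 ^ β * (ω * (dyadicConst ε * (2 ^ k) ^ ε +
          ((2 ^ k) ^ d * (2 ^ k) ^ (-β)) * dyadicConst β)) := by ring
    _ = _ := by
        rw [← ENNReal.rpow_add _ _ (ENNReal.two_zpow_ne_zero k) (ENNReal.two_zpow_ne_top k),
          ← hβε, show β + ε + -β = ε by ring]
        ring

/-- The mean oscillation of `f` around `u ∈ G` at scale `2 ^ k`, relative to the set `G`. -/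
noncomputable def localOscillation (G : Set E) (f : E → ℝ) (k : ℤ) : E → ℝ≥0∞ :=
  G.indicator fun u => (2 ^ k) ^ (-(finrank ℝ E : ℝ)) *
    ∫⁻ w in closedBall u (2 ^ (k + 1)), G.indicator (fun w => ‖f u - f w‖ₑ) w ∂μ

variable {G : Set E} {f : E → ℝ}

theorem measurable_localOscillation (hG : MeasurableSet G) (hf : Measurable f) (k : ℤ) :
    Measurable (localOscillation μ G f k) := by
  refine Measurable.indicator (Measurable.const_mul ?_ _) hG
  have hF : Measurable (Function.uncurry fun u w : E => G.indicator (fun w => ‖f u - f w‖ₑ) w) := by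
    have h1 : Measurable fun q : E × E => ‖f q.1 - f q.2‖ₑ := by fun_prop
    exact h1.indicator (measurable_snd hG)
  have h := measurable_lintegral_closedBall_prod μ hF (2 ^ (k + 1))
  -- The centre of the ball and the base point of the difference are separate variables in `h`; here
  -- they are identified.
  exact h.comp (f := fun u : E => (u, u)) (by fun_prop)

/-- Jensen on a ball of measure comparable to `2 ^ (kd)`, with exponents adding up as `-dp + d(p -
1) = -d`. The condition on the distance is written with `‖u - w‖ₑ / 2` so that `tsum_dyadic_ge` can
sum over `k`. -/
theorem localOscillation_rpow_le {p : ℝ} (hp : 1 < p) (hG : MeasurableSet G) (hf : Measurable f)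
    (k : ℤ) {u : E} (hu : u ∈ G) :
    localOscillation μ G f k u ^ p ≤ (2 ^ (finrank ℝ E : ℝ) * μ (ball 0 1)) ^ (p - 1) *
      ∫⁻ w in G, (if ‖u - w‖ₑ / 2 ≤ 2 ^ k then ((2 : ℝ≥0∞) ^ k) ^ (-(finrank ℝ E : ℝ)) else 0) *
        ‖f u - f w‖ₑ ^ p ∂μ := by
  set d : ℝ := (finrank ℝ E : ℝ)
  set ω := μ (ball (0 : E) 1)
  have hd0 : 0 ≤ d := Nat.cast_nonneg _
  have hp0 : 0 < p := by linarith
  have h0 := ENNReal.two_zpow_ne_zero k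
  have h1 := ENNReal.two_zpow_ne_top k
  have hm : Measurable (G.indicator fun w => ‖f u - f w‖ₑ) :=
    Measurable.indicator (by fun_prop) hG
  rw [localOscillation, indicator_of_mem hu]
  calc (((2 : ℝ≥0∞) ^ k) ^ (-d) *
        ∫⁻ w in closedBall u (2 ^ (k + 1)), G.indicator (fun w => ‖f u - f w‖ₑ) w ∂μ) ^ p
      ≤ (((2 : ℝ≥0∞) ^ k) ^ (-d)) ^ p * (((2 ^ (k + 1)) ^ d * ω) ^ (p - 1) *
        ∫⁻ w in closedBall u (2 ^ (k + 1)), G.indicator (fun w => ‖f u - f w‖ₑ) w ^ p ∂μ) := by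
        rw [ENNReal.mul_rpow_of_nonneg _ _ hp0.le, ← addHaar_closedBall_two_zpow μ u]
        gcongr
        exact rpow_setLIntegral_le hp hm _
    _ = (2 ^ d * ω) ^ (p - 1) * (((2 : ℝ≥0∞) ^ k) ^ (-d) *
        ∫⁻ w in closedBall u (2 ^ (k + 1)), G.indicator (fun w => ‖f u - f w‖ₑ) w ^ p ∂μ) := by
        rw [ENNReal.zpow_add two_ne_zero ENNReal.ofNat_ne_top, zpow_one,
          ENNReal.mul_rpow_of_nonneg _ _ hd0, mul_assoc ((2 ^ k) ^ d),
          ENNReal.mul_rpow_of_nonneg _ _ (by linarith : (0 : ℝ) ≤ p - 1), ← ENNReal.rpow_mul,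
          ← ENNReal.rpow_mul,
          show (-d) = -d * p + d * (p - 1) by ring, ENNReal.rpow_add _ _ h0 h1]
        ring_nf
    _ = (2 ^ d * ω) ^ (p - 1) * ∫⁻ w in G,
        (if ‖u - w‖ₑ / 2 ≤ 2 ^ k then ((2 : ℝ≥0∞) ^ k) ^ (-d) else 0) * ‖f u - f w‖ₑ ^ p ∂μ := by
        rw [← lintegral_const_mul' _ _ (ENNReal.rpow_ne_top_of_ne_zero h0 h1),
          ← lintegral_indicator measurableSet_closedBall, ← lintegral_indicator hG]
        congr 1
        refine lintegral_congr fun w => ?_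
        have hiff : w ∈ closedBall u (2 ^ (k + 1)) ↔ ‖u - w‖ₑ / 2 ≤ 2 ^ k := by
          rw [mem_closedBall_two_zpow_iff, ENNReal.div_le_iff two_ne_zero ENNReal.ofNat_ne_top,
            ENNReal.zpow_add two_ne_zero ENNReal.ofNat_ne_top, zpow_one]
        by_cases hw : w ∈ G <;> by_cases hw' : ‖u - w‖ₑ / 2 ≤ 2 ^ k <;>
          simp [indicator, hw, hiff, hw', hp0]

/-- Summing the oscillations over all scales recovers the fractional seminorm. -/
theorem tsum_lintegral_localOscillation_le {p θ : ℝ} (hp : 1 < p) (hθ : 0 < θ)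
    (hG : MeasurableSet G) (hf : Measurable f) :
    ∑' k : ℤ, ((2 : ℝ≥0∞) ^ k) ^ (-θ) * ∫⁻ u, localOscillation μ G f k u ^ p ∂μ ≤
      (2 ^ (finrank ℝ E : ℝ) * μ (ball 0 1)) ^ (p - 1) *
        (dyadicConst (finrank ℝ E + θ) * 2 ^ (finrank ℝ E + θ)) *
      ∫⁻ u in G, ∫⁻ w in G, ‖f u - f w‖ₑ ^ p / ‖u - w‖ₑ ^ (finrank ℝ E + θ) ∂μ ∂μ := by
  set d : ℝ := (finrank ℝ E : ℝ)
  set ω := μ (ball (0 : E) 1)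
  have hd0 : 0 ≤ d := Nat.cast_nonneg _
  have hβ : 0 < d + θ := by linarith
  have hp0 : 0 < p := by linarith
  have hωt : ω ≠ ∞ := measure_ball_lt_top.ne
  have hA : (2 ^ d * ω) ^ (p - 1) ≠ ∞ := ENNReal.rpow_ne_top_of_nonneg (by linarith)
    (ENNReal.mul_ne_top (ENNReal.rpow_ne_top_of_nonneg hd0 ENNReal.ofNat_ne_top) hωt)
  have hB : dyadicConst (d + θ) * 2 ^ (d + θ) ≠ ∞ := ENNReal.mul_ne_top (dyadicConst_ne_top hβ)
    (ENNReal.rpow_ne_top_of_nonneg hβ.le ENNReal.ofNat_ne_top)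
  have hpt : ∀ u ∈ G, ∑' k : ℤ, ((2 : ℝ≥0∞) ^ k) ^ (-θ) * localOscillation μ G f k u ^ p ≤
      (2 ^ d * ω) ^ (p - 1) * (dyadicConst (d + θ) * 2 ^ (d + θ)) *
        ∫⁻ w in G, ‖f u - f w‖ₑ ^ p / ‖u - w‖ₑ ^ (d + θ) ∂μ := by
    intro u hu
    calc _ ≤ ∑' k : ℤ, ((2 : ℝ≥0∞) ^ k) ^ (-θ) * ((2 ^ d * ω) ^ (p - 1) *
          ∫⁻ w in G, (if ‖u - w‖ₑ / 2 ≤ 2 ^ k then ((2 : ℝ≥0∞) ^ k) ^ (-d) else 0) *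
            ‖f u - f w‖ₑ ^ p ∂μ) := by
          gcongr with k
          exact localOscillation_rpow_le μ hp hG hf k hu
      _ = (2 ^ d * ω) ^ (p - 1) * ∫⁻ w in G, (∑' k : ℤ,
          (if ‖u - w‖ₑ / 2 ≤ 2 ^ k then ((2 : ℝ≥0∞) ^ k) ^ (-(d + θ)) else 0)) *
            ‖f u - f w‖ₑ ^ p ∂μ := by
          simp_rw [← ENNReal.tsum_mul_right]
          rw [lintegral_tsum fun k => ?_, ← ENNReal.tsum_mul_left]
          · refine tsum_congr fun k => ?_
            have h0 := ENNReal.two_zpow_ne_zero k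
            have h1 := ENNReal.two_zpow_ne_top k
            rw [mul_left_comm, ← lintegral_const_mul' _ _ (ENNReal.rpow_ne_top_of_ne_zero h0 h1)]
            congr 2 with w
            rw [← mul_assoc, mul_ite, mul_zero, ← ENNReal.rpow_add _ _ h0 h1, neg_add_rev]
          · exact ((Measurable.ite (measurableSet_le (by fun_prop) measurable_const)
              measurable_const measurable_const).mul (by fun_prop)).aemeasurable
      _ ≤ (2 ^ d * ω) ^ (p - 1) * ∫⁻ w in G, (dyadicConst (d + θ) * 2 ^ (d + θ)) *
            (‖f u - f w‖ₑ ^ p / ‖u - w‖ₑ ^ (d + θ)) ∂μ := by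
          refine mul_le_mul_right (lintegral_mono fun w => ?_) _
          -- For fixed `u` and `w`, only scales `2 ^ k ≥ |u - w| / 2` see the pair, and their sum is
          -- comparable to its largest possible term.
          calc _ ≤ (dyadicConst (d + θ) * (‖u - w‖ₑ / 2) ^ (-(d + θ))) * ‖f u - f w‖ₑ ^ p := by
                gcongr
                exact tsum_dyadic_ge hβ _
            _ = _ := by
                rw [ENNReal.rpow_neg, ENNReal.div_rpow_of_nonneg _ _ hβ.le, ENNReal.inv_div
                  (Or.inl (ENNReal.rpow_ne_top_of_nonneg hβ.le ENNReal.ofNat_ne_top))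
                  (Or.inl (ENNReal.rpow_pos two_pos ENNReal.ofNat_ne_top).ne')]
                simp only [div_eq_mul_inv]
                ring
      _ = _ := by
          rw [lintegral_const_mul' _ _ hB]
          ring
  have hT := measurable_localOscillation μ hG hf
  calc _ = ∫⁻ u, ∑' k : ℤ, ((2 : ℝ≥0∞) ^ k) ^ (-θ) * localOscillation μ G f k u ^ p ∂μ := by
        rw [lintegral_tsum fun k => (((hT k).pow_const p).const_mul _).aemeasurable]
        refine tsum_congr fun k => ?_
        rw [lintegral_const_mul _ ((hT k).pow_const p)]
    _ ≤ ∫⁻ u in G, (2 ^ d * ω) ^ (p - 1) * (dyadicConst (d + θ) * 2 ^ (d + θ)) *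
        ∫⁻ w in G, ‖f u - f w‖ₑ ^ p / ‖u - w‖ₑ ^ (d + θ) ∂μ ∂μ := by
        rw [← lintegral_indicator hG]
        refine lintegral_mono fun u => ?_
        by_cases hu : u ∈ G
        · rw [indicator_of_mem hu]
          exact hpt u hu
        · simp [localOscillation, hu, hp0]
    _ = _ := lintegral_const_mul' _ _ (ENNReal.mul_ne_top hA hB)

end Oscillation

/-! ### Comparison of averages of `|f|` over balls. -/

section BallMean

open Module

set_option linter.unusedSectionVars false

variable {E : Type*} [NormedAddCommGroup E] [NormedSpace ℝ E] [FiniteDimensional ℝ E]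
  [MeasurableSpace E] [BorelSpace E] (μ : Measure E) [μ.IsAddHaarMeasure]

theorem lintegral_comp_add_smul (h : E → ℝ≥0∞) (x : E) {r : ℝ} (hr : 0 < r) :
    ∫⁻ z, h (x + r • z) ∂μ = (ENNReal.ofReal r ^ (finrank ℝ E : ℝ))⁻¹ * ∫⁻ z, h z ∂μ := by
  have he : MeasurableEmbedding fun z : E => r • z :=
    (Homeomorph.smulOfNeZero r hr.ne').measurableEmbedding
  have := he.lintegral_map (μ := μ) (fun v => h (x + v))
  rw [← this, Measure.map_addHaar_smul μ hr.ne', lintegral_smul_measure,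
    lintegral_add_left_eq_self h x, smul_eq_mul, abs_of_pos (by positivity),
    ENNReal.ofReal_inv_of_pos (by positivity), ENNReal.ofReal_pow hr.le, ENNReal.rpow_natCast]

/-- The mean over a ball, as an integral over the unit ball. -/
theorem laverage_ball_eq (g : E → ℝ≥0∞) (x : E) {r : ℝ} (hr : 0 < r) :
    ⨍⁻ y in ball x r, g y ∂μ =
      (μ (ball 0 1))⁻¹ * ∫⁻ z in ball (0 : E) 1, g (x + r • z) ∂μ := by
  have h := lintegral_comp_add_smul μ ((ball x r).indicator g) x hr
  have hind : ∀ z, (ball x r).indicator g (x + r • z) =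
      (ball (0 : E) 1).indicator (fun z => g (x + r • z)) z := by
    intro z
    have : x + r • z ∈ ball x r ↔ z ∈ ball (0 : E) 1 := by
      simp [mem_ball, dist_eq_norm, norm_smul, abs_of_pos hr, hr]
    by_cases hz : z ∈ ball (0 : E) 1
    · rw [indicator_of_mem (this.2 hz), indicator_of_mem hz]
    · rw [indicator_of_notMem (mt this.1 hz), indicator_of_notMem hz]
  simp_rw [hind] at h
  rw [lintegral_indicator measurableSet_ball, lintegral_indicator measurableSet_ball] at h
  rw [setLAverage_eq, h, addHaar_ball_rpow μ x hr, ENNReal.div_eq_inv_mul, ENNReal.mul_inv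
    (Or.inr measure_ball_lt_top.ne) (Or.inr (measure_ball_pos μ 0 one_pos).ne')]
  ring

theorem laverage_ball_le_dyadicMaximal (g : E → ℝ≥0∞) (x : E) {r : ℝ} (hr : 0 < r) :
    ⨍⁻ y in ball x r, g y ∂μ ≤
      (μ (ball 0 1))⁻¹ * 2 ^ (finrank ℝ E : ℝ) * dyadicMaximal μ g x := by
  have hr0 : ENNReal.ofReal r ^ (finrank ℝ E : ℝ) ≠ 0 :=
    (ENNReal.rpow_pos (ENNReal.ofReal_pos.2 hr) ENNReal.ofReal_ne_top).ne'
  have hrt : ENNReal.ofReal r ^ (finrank ℝ E : ℝ) ≠ ∞ :=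
    ENNReal.rpow_ne_top_of_nonneg (Nat.cast_nonneg _) ENNReal.ofReal_ne_top
  rw [setLAverage_eq, addHaar_ball_rpow μ x hr, ENNReal.div_eq_inv_mul, ENNReal.mul_inv
    (Or.inr measure_ball_lt_top.ne) (Or.inr (measure_ball_pos μ 0 one_pos).ne')]
  calc _ ≤ (ENNReal.ofReal r ^ (finrank ℝ E : ℝ))⁻¹ * (μ (ball 0 1))⁻¹ *
        (2 ^ (finrank ℝ E : ℝ) * ENNReal.ofReal r ^ (finrank ℝ E : ℝ) * dyadicMaximal μ g x) := by
        gcongr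
        exact lintegral_ball_le_dyadicMaximal μ g x hr
    _ = ((ENNReal.ofReal r ^ (finrank ℝ E : ℝ))⁻¹ * ENNReal.ofReal r ^ (finrank ℝ E : ℝ)) *
        ((μ (ball 0 1))⁻¹ * 2 ^ (finrank ℝ E : ℝ) * dyadicMaximal μ g x) := by ring
    _ = _ := by rw [ENNReal.inv_mul_cancel hr0 hrt, one_mul]

theorem enorm_le_enorm_add_enorm_sub (a b : ℝ) : ‖a‖ₑ ≤ ‖b‖ₑ + ‖a - b‖ₑ := by
  simpa using enorm_add_le b (a - b)

theorem laverage_ball_enorm_le_add (f : E → ℝ) (x : E) (c : ℝ) {r : ℝ} (hr : 0 < r) :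
    ⨍⁻ z in ball x r, ‖f z‖ₑ ∂μ ≤ ‖c‖ₑ + ⨍⁻ z in ball x r, ‖f z - c‖ₑ ∂μ := by
  have h0 : μ (ball x r) ≠ 0 := (measure_ball_pos μ x hr).ne'
  have h1 : μ (ball x r) ≠ ∞ := measure_ball_lt_top.ne
  rw [setLAverage_eq, setLAverage_eq]
  calc _ ≤ (∫⁻ z in ball x r, (‖c‖ₑ + ‖f z - c‖ₑ) ∂μ) / μ (ball x r) := by
        gcongr with z
        exact enorm_le_enorm_add_enorm_sub _ _
    _ = _ := by
        rw [lintegral_add_left measurable_const, setLIntegral_const, ENNReal.add_div,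
          ENNReal.mul_div_cancel_right h0 h1]

variable {G : Set E} {f : E → ℝ}

/-- The difference quotient of order `γ` of `f` on `G`. -/
noncomputable def diffQuotient (G : Set E) (f : E → ℝ) (γ : ℝ) (x y : E) : ℝ≥0∞ :=
  (G ×ˢ G).indicator (fun q : E × E => ‖f q.1 - f q.2‖ₑ / ‖q.1 - q.2‖ₑ ^ γ) (x, y)

theorem diffQuotient_comm (γ : ℝ) (x y : E) :
    diffQuotient G f γ x y = diffQuotient G f γ y x := by
  unfold diffQuotient
  have h1 : ‖f x - f y‖ₑ = ‖f y - f x‖ₑ := by rw [← enorm_neg, neg_sub]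
  have h2 : ‖x - y‖ₑ = ‖y - x‖ₑ := by rw [← enorm_neg, neg_sub]
  by_cases h : x ∈ G ∧ y ∈ G
  · rw [indicator_of_mem (mk_mem_prod h.1 h.2), indicator_of_mem (mk_mem_prod h.2 h.1), h1, h2]
  · rw [indicator_of_notMem (by simpa using h), indicator_of_notMem (by simpa [and_comm] using h)]

theorem measurable_diffQuotient (hG : MeasurableSet G) (hf : Measurable f) (γ : ℝ) :
    Measurable (Function.uncurry (diffQuotient G f γ)) := by
  have h : Measurable fun q : E × E => ‖f q.1 - f q.2‖ₑ / ‖q.1 - q.2‖ₑ ^ γ := by fun_prop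
  exact h.indicator (hG.prod hG)

theorem enorm_sub_le_diffQuotient {γ : ℝ} (hγ : 0 ≤ γ) {x y : E} (hx : x ∈ G) (hy : y ∈ G) :
    ‖f x - f y‖ₑ ≤ diffQuotient G f γ x y * ‖x - y‖ₑ ^ γ := by
  rw [diffQuotient, indicator_of_mem (mk_mem_prod hx hy)]
  rcases eq_or_ne x y with rfl | h
  · simp
  have h0 : ‖x - y‖ₑ ≠ 0 := by simpa [sub_eq_zero] using h
  rw [ENNReal.div_mul_cancel (ENNReal.rpow_pos (pos_iff_ne_zero.2 h0) enorm_ne_top).ne'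
    (ENNReal.rpow_ne_top_of_nonneg hγ enorm_ne_top)]

theorem lintegral_diffQuotient_rpow {p γ : ℝ} (hp : 0 < p) (hG : MeasurableSet G) :
    ∫⁻ x, ∫⁻ y, diffQuotient G f γ x y ^ p ∂μ ∂μ =
      ∫⁻ x in G, ∫⁻ y in G, ‖f x - f y‖ₑ ^ p / ‖x - y‖ₑ ^ (γ * p) ∂μ ∂μ := by
  rw [← lintegral_indicator hG]
  refine lintegral_congr fun x => ?_
  by_cases hx : x ∈ G
  · rw [indicator_of_mem hx, ← lintegral_indicator hG]
    refine lintegral_congr fun y => ?_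
    by_cases hy : y ∈ G
    · simp [diffQuotient, hx, hy, ENNReal.div_rpow_of_nonneg _ _ hp.le, ENNReal.rpow_mul]
    · simp [diffQuotient, hy, hp]
  · simp [diffQuotient, hx, hp]

/-- Every `z` in the ball is within `2|x - y|` of `y`, so `|f z - f y|` is at most `(2|x - y|) ^ γ`
times the difference quotient based at `y`. The average of that quotient around `x` is bounded by
its maximal function. -/
theorem laverage_ball_le_of_le_dist {γ : ℝ} (hγ : 0 ≤ γ) {x y : E} {r : ℝ} (hr : 0 < r)
    (hrxy : r ≤ dist x y) (hy : y ∈ G) (hball : ball x r ⊆ G) :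
    ⨍⁻ z in ball x r, ‖f z‖ₑ ∂μ ≤ ‖f y‖ₑ + (μ (ball 0 1))⁻¹ * 2 ^ (finrank ℝ E : ℝ) *
      (2 * ‖x - y‖ₑ) ^ γ * dyadicMaximal μ (diffQuotient G f γ y) x := by
  refine (laverage_ball_enorm_le_add μ f x (f y) hr).trans (add_le_add_right ?_ _)
  have hc : (2 * ‖x - y‖ₑ) ^ γ ≠ ∞ := ENNReal.rpow_ne_top_of_nonneg hγ
    (ENNReal.mul_ne_top ENNReal.ofNat_ne_top enorm_ne_top)
  calc ⨍⁻ z in ball x r, ‖f z - f y‖ₑ ∂μ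
      ≤ (2 * ‖x - y‖ₑ) ^ γ * ⨍⁻ z in ball x r, diffQuotient G f γ y z ∂μ := by
        rw [setLAverage_eq, setLAverage_eq, ← mul_div_assoc, ← lintegral_const_mul' _ _ hc]
        refine ENNReal.div_le_div_right (setLIntegral_mono' measurableSet_ball fun z hz => ?_) _
        refine (enorm_sub_le_diffQuotient hγ (hball hz) hy).trans ?_
        rw [diffQuotient_comm, mul_comm]
        gcongr
        rw [← edist_eq_enorm_sub, ← edist_eq_enorm_sub]
        calc edist z y ≤ edist z x + edist x y := edist_triangle _ _ _
          _ ≤ edist x y + edist x y := by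
              gcongr
              rw [edist_dist, edist_dist]
              exact ENNReal.ofReal_le_ofReal (hz.le.trans hrxy)
          _ = _ := (two_mul _).symm
    _ ≤ (2 * ‖x - y‖ₑ) ^ γ * ((μ (ball 0 1))⁻¹ * 2 ^ (finrank ℝ E : ℝ) *
          dyadicMaximal μ (diffQuotient G f γ y) x) := by
        gcongr
        exact laverage_ball_le_dyadicMaximal μ _ x hr
    _ = _ := by ring

/-- Recovering the unnormalized integral from the mean oscillation. -/
theorem setLIntegral_enorm_sub_le_localOscillation (k : ℤ) {u : E} (hu : u ∈ G)
    {s : Set E} (hs : MeasurableSet s) (hsG : s ⊆ G) (hsu : s ⊆ closedBall u (2 ^ (k + 1))) :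
    ∫⁻ w in s, ‖f u - f w‖ₑ ∂μ ≤
      (2 ^ k) ^ (finrank ℝ E : ℝ) * localOscillation μ G f k u := by
  have h0 := ENNReal.two_zpow_ne_zero k
  have h1 := ENNReal.two_zpow_ne_top k
  rw [localOscillation, indicator_of_mem hu, ← mul_assoc, ← ENNReal.rpow_add _ _ h0 h1,
    add_neg_cancel, ENNReal.rpow_zero, one_mul]
  calc ∫⁻ w in s, ‖f u - f w‖ₑ ∂μ = ∫⁻ w in s, G.indicator (fun w => ‖f u - f w‖ₑ) w ∂μ :=
        setLIntegral_congr_fun hs fun w hw => by rw [indicator_of_mem (hsG hw)]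
    _ ≤ _ := lintegral_mono_set hsu

theorem inv_measure_ball_mul_le {r : ℝ} {k : ℤ} (hr : 0 < r) (hk : (2 : ℝ) ^ k ≤ 2 * r) (x : E) :
    (μ (ball x r))⁻¹ * (2 ^ k) ^ (finrank ℝ E : ℝ) ≤
      (μ (ball 0 1))⁻¹ * 2 ^ (finrank ℝ E : ℝ) := by
  set d : ℝ := (finrank ℝ E : ℝ)
  have hd : 0 ≤ d := Nat.cast_nonneg _
  have hr0 : ENNReal.ofReal r ^ d ≠ 0 :=
    (ENNReal.rpow_pos (ENNReal.ofReal_pos.2 hr) ENNReal.ofReal_ne_top).ne'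
  have hrt : ENNReal.ofReal r ^ d ≠ ∞ := ENNReal.rpow_ne_top_of_nonneg hd ENNReal.ofReal_ne_top
  rw [addHaar_ball_rpow μ x hr, ENNReal.mul_inv
    (Or.inr measure_ball_lt_top.ne) (Or.inr (measure_ball_pos μ 0 one_pos).ne')]
  calc _ ≤ (ENNReal.ofReal r ^ d)⁻¹ * (μ (ball 0 1))⁻¹ * (2 * ENNReal.ofReal r) ^ d := by
        gcongr
        rw [← ENNReal.ofReal_two_zpow, ← ENNReal.ofReal_ofNat, ← ENNReal.ofReal_mul (by norm_num)]
        exact ENNReal.ofReal_le_ofReal hk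
    _ = ((ENNReal.ofReal r ^ d)⁻¹ * ENNReal.ofReal r ^ d) * ((μ (ball 0 1))⁻¹ * 2 ^ d) := by
        rw [ENNReal.mul_rpow_of_nonneg _ _ hd]
        ring
    _ = _ := by rw [ENNReal.inv_mul_cancel hr0 hrt, one_mul]

theorem laverage_ball_le_of_dist_le {x y : E} {r : ℝ} (hr : 0 < r) {k : ℤ}
    (hk : (2 : ℝ) ^ k ≤ 2 * r) (hk' : r ≤ 2 ^ k) (hrxy : dist x y ≤ r)
    (hy : y ∈ G) (hball : ball x r ⊆ G) :
    ⨍⁻ z in ball x r, ‖f z‖ₑ ∂μ ≤ ‖f y‖ₑ + (μ (ball 0 1))⁻¹ * 2 ^ (finrank ℝ E : ℝ) *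
      localOscillation μ G f k y := by
  refine (laverage_ball_enorm_le_add μ f x (f y) hr).trans (add_le_add_right ?_ _)
  -- The radius `2 ^ (k + 1)` in `localOscillation` leaves room both for `r ≤ 2 ^ k` and for the
  -- displacement `dist x y ≤ r`.
  have hsub : ball x r ⊆ closedBall y (2 ^ (k + 1)) := by
    refine ball_subset_closedBall.trans (closedBall_subset_closedBall' ?_)
    rw [zpow_add₀ two_ne_zero, zpow_one]
    linarith
  have hswap : ∀ z, ‖f z - f y‖ₑ = ‖f y - f z‖ₑ := fun z => by rw [← enorm_neg, neg_sub]
  rw [setLAverage_eq, ENNReal.div_eq_inv_mul]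
  simp_rw [hswap]
  calc _ ≤ (μ (ball x r))⁻¹ * ((2 ^ k) ^ (finrank ℝ E : ℝ) * localOscillation μ G f k y) := by
        gcongr
        exact setLIntegral_enorm_sub_le_localOscillation μ k hy measurableSet_ball hball hsub
    _ ≤ _ := by
        rw [← mul_assoc]
        exact mul_le_mul_left (inv_measure_ball_mul_le μ hr hk x) _

/-- The triangle inequality through `f w` is averaged over `w` in the ball `B(c,ρ)`, which lies in
the oscillation windows of both `u` and `v`. -/
theorem enorm_sub_le_localOscillation {c u v : E} {ρ : ℝ} (hρ : 0 < ρ) {k : ℤ}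
    (hk : (2 : ℝ) ^ k ≤ 2 * ρ) (hk' : ρ ≤ 2 ^ k) (hu : u ∈ G) (hv : v ∈ G)
    (hcu : dist c u ≤ ρ) (hcv : dist c v ≤ ρ) (hball : ball c ρ ⊆ G) (hf : Measurable f) :
    ‖f u - f v‖ₑ ≤ (μ (ball 0 1))⁻¹ * 2 ^ (finrank ℝ E : ℝ) *
      (localOscillation μ G f k u + localOscillation μ G f k v) := by
  have h0 : μ (ball c ρ) ≠ 0 := (measure_ball_pos μ c hρ).ne'
  have h1 : μ (ball c ρ) ≠ ∞ := measure_ball_lt_top.ne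
  have hsub : ∀ a, dist c a ≤ ρ → ball c ρ ⊆ closedBall a (2 ^ (k + 1)) := fun a ha => by
    refine ball_subset_closedBall.trans (closedBall_subset_closedBall' ?_)
    rw [zpow_add₀ two_ne_zero, zpow_one]
    linarith
  have htri : ∀ w, ‖f u - f v‖ₑ ≤ ‖f u - f w‖ₑ + ‖f v - f w‖ₑ := fun w => by
    have h := enorm_sub_le (E := ℝ) (a := f u - f w) (b := f v - f w)
    simpa using h
  calc ‖f u - f v‖ₑ = (μ (ball c ρ))⁻¹ * ∫⁻ _ in ball c ρ, ‖f u - f v‖ₑ ∂μ := by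
        rw [setLIntegral_const, mul_comm, mul_assoc, ENNReal.mul_inv_cancel h0 h1, mul_one]
    _ ≤ (μ (ball c ρ))⁻¹ * ∫⁻ w in ball c ρ, (‖f u - f w‖ₑ + ‖f v - f w‖ₑ) ∂μ := by
        gcongr with w
        exact htri w
    _ ≤ (μ (ball c ρ))⁻¹ * ((2 ^ k) ^ (finrank ℝ E : ℝ) * localOscillation μ G f k u +
          (2 ^ k) ^ (finrank ℝ E : ℝ) * localOscillation μ G f k v) := by
        rw [lintegral_add_left (by fun_prop)]
        gcongr
        · exact setLIntegral_enorm_sub_le_localOscillation μ k hu measurableSet_ball hball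
            (hsub u hcu)
        · exact setLIntegral_enorm_sub_le_localOscillation μ k hv measurableSet_ball hball
            (hsub v hcv)
    _ ≤ _ := by
        rw [← mul_add, ← mul_assoc]
        exact mul_le_mul_left (inv_measure_ball_mul_le μ hρ hk c) _

/-- The point `x + r • z` is matched with `y + (r - ρ) • z` for `z` in the unit ball. Both are
within `ρ` of `x + (r - ρ) • z`, and the ball of radius `ρ` about that point stays inside `B(x,r)`.
The error is thus an average of oscillations at scale `ρ`, however large `r` is. -/
theorem laverage_ball_le_laverage_ball_add (hG : MeasurableSet G) (hf : Measurable f)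
    {x y : E} {r ρ : ℝ} (hρ : 0 < ρ) (hρr : ρ < r)
    {k : ℤ} (hk : (2 : ℝ) ^ k ≤ 2 * ρ) (hk' : ρ ≤ 2 ^ k) (hxy : dist x y ≤ ρ)
    (hball : ball x r ⊆ G) :
    ⨍⁻ z in ball x r, ‖f z‖ₑ ∂μ ≤ ⨍⁻ z in ball y (r - ρ), ‖f z‖ₑ ∂μ +
      ((μ (ball 0 1))⁻¹ * 2 ^ (finrank ℝ E : ℝ)) ^ 2 *
        (dyadicMaximal μ (localOscillation μ G f k) x +
          dyadicMaximal μ (localOscillation μ G f k) y) := by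
  set T := localOscillation μ G f k
  have hT : Measurable T := measurable_localOscillation μ hG hf k
  set A := (μ (ball (0 : E) 1))⁻¹ * 2 ^ (finrank ℝ E : ℝ)
  have hA : A ≠ ∞ := ENNReal.mul_ne_top
    (ENNReal.inv_ne_top.2 (measure_ball_pos μ 0 one_pos).ne')
    (ENNReal.rpow_ne_top_of_nonneg (Nat.cast_nonneg _) ENNReal.ofNat_ne_top)
  have hr : 0 < r := hρ.trans hρr
  have hr' : 0 < r - ρ := sub_pos.2 hρr
  have hpt : ∀ z ∈ ball (0 : E) 1, ‖f (x + r • z)‖ₑ ≤ ‖f (y + (r - ρ) • z)‖ₑ +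
      A * (T (x + r • z) + T (y + (r - ρ) • z)) := by
    intro z hz
    have hz1 : ‖z‖ < 1 := by simpa using hz
    have hc : ball (x + (r - ρ) • z) ρ ⊆ ball x r := by
      refine ball_subset_ball' ?_
      rw [dist_self_add_left, norm_smul, Real.norm_of_nonneg hr'.le]
      nlinarith
    have hu : x + r • z ∈ ball x r := by
      rw [mem_ball, dist_self_add_left, norm_smul, Real.norm_of_nonneg hr.le]
      nlinarith
    have hv : y + (r - ρ) • z ∈ ball x r := by
      rw [mem_ball]
      calc dist (y + (r - ρ) • z) x ≤ dist (y + (r - ρ) • z) y + dist y x := dist_triangle _ _ _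
        _ ≤ (r - ρ) * ‖z‖ + ρ := by
            rw [dist_self_add_left, norm_smul, Real.norm_of_nonneg hr'.le, dist_comm y x]
            gcongr
        _ < r := by nlinarith
    refine (enorm_le_enorm_add_enorm_sub _ (f (y + (r - ρ) • z))).trans (add_le_add_right ?_ _)
    refine enorm_sub_le_localOscillation μ (c := x + (r - ρ) • z) hρ hk hk' (hball hu) (hball hv)
      ?_ ?_ (hc.trans hball) hf
    · rw [dist_add_left, dist_eq_norm, ← sub_smul, norm_smul, Real.norm_eq_abs,
        show r - ρ - r = -ρ by ring, abs_neg, abs_of_pos hρ]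
      nlinarith
    · rwa [dist_add_right]
  have hmT : Measurable fun z : E => T (x + r • z) := hT.comp (by fun_prop)
  have hmT' : Measurable fun z : E => T (y + (r - ρ) • z) := hT.comp (by fun_prop)
  have hmf : Measurable fun z : E => ‖f (y + (r - ρ) • z)‖ₑ := by fun_prop
  calc ⨍⁻ z in ball x r, ‖f z‖ₑ ∂μ
      = (μ (ball 0 1))⁻¹ * ∫⁻ z in ball (0 : E) 1, ‖f (x + r • z)‖ₑ ∂μ :=
        laverage_ball_eq μ _ x hr
    _ ≤ (μ (ball 0 1))⁻¹ * ∫⁻ z in ball (0 : E) 1, (‖f (y + (r - ρ) • z)‖ₑ +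
          A * (T (x + r • z) + T (y + (r - ρ) • z))) ∂μ := by
        refine mul_le_mul_right (setLIntegral_mono' measurableSet_ball hpt) _
    _ = ⨍⁻ z in ball y (r - ρ), ‖f z‖ₑ ∂μ +
          A * (⨍⁻ z in ball x r, T z ∂μ + ⨍⁻ z in ball y (r - ρ), T z ∂μ) := by
        rw [lintegral_add_left hmf, lintegral_const_mul' _ _ hA, lintegral_add_left hmT,
          laverage_ball_eq μ _ x hr, laverage_ball_eq μ _ y hr', laverage_ball_eq μ _ y hr']
        ring
    _ ≤ ⨍⁻ z in ball y (r - ρ), ‖f z‖ₑ ∂μ +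
          A * (A * dyadicMaximal μ T x + A * dyadicMaximal μ T y) := by
        gcongr
        · exact laverage_ball_le_dyadicMaximal μ T x hr
        · exact laverage_ball_le_dyadicMaximal μ T y hr'
    _ = _ := by ring

end BallMean

/-! ### The majorant, its integral and its lower bounds. -/

section Majorant

open Module

set_option linter.unusedSectionVars false

variable {E : Type*} [NormedAddCommGroup E] [NormedSpace ℝ E] [FiniteDimensional ℝ E]
  [MeasurableSpace E] [BorelSpace E] (μ : Measure E) [μ.IsAddHaarMeasure]

/-- The `p`-th powers of the mean oscillation at scale `2 ^ k` and of its maximal function. -/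
noncomputable def scaleEnergy (G : Set E) (f : E → ℝ) (p : ℝ) (k : ℤ) (x : E) : ℝ≥0∞ :=
  localOscillation μ G f k x ^ p + dyadicMaximal μ (localOscillation μ G f k) x ^ p

/-- The part of the majorant collecting the oscillations at all scales above `|x - y|`. -/
noncomputable def scaleMajorant (G : Set E) (f : E → ℝ) (p θ ε : ℝ) (x y : E) : ℝ≥0∞ :=
  ∑' k : ℤ, (2 ^ k) ^ (-(ε + θ)) * (truncatedKernel (finrank ℝ E - ε) k x y *
    (scaleEnergy μ G f p k x + scaleEnergy μ G f p k y))

/-- A function on `E × E` whose integral is controlled by the fractional seminorm, and which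
controls the differences of the local maximal function of `f`. -/
noncomputable def majorant (G : Set E) (f : E → ℝ) (p θ ε : ℝ) (x y : E) : ℝ≥0∞ :=
  diffQuotient G f ((finrank ℝ E + θ) / p) x y ^ p +
    dyadicMaximal μ (diffQuotient G f ((finrank ℝ E + θ) / p) y) x ^ p +
    dyadicMaximal μ (diffQuotient G f ((finrank ℝ E + θ) / p) x) y ^ p +
    scaleMajorant μ G f p θ ε x y

variable {G : Set E} {f : E → ℝ}

theorem scaleMajorant_comm (p θ ε : ℝ) (x y : E) :
    scaleMajorant μ G f p θ ε x y = scaleMajorant μ G f p θ ε y x := by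
  refine tsum_congr fun k => ?_
  rw [truncatedKernel_comm, add_comm (scaleEnergy μ G f p k x)]

theorem majorant_comm (p θ ε : ℝ) (x y : E) :
    majorant μ G f p θ ε x y = majorant μ G f p θ ε y x := by
  unfold majorant
  rw [diffQuotient_comm, scaleMajorant_comm]
  ring

theorem measurable_scaleEnergy (hG : MeasurableSet G) (hf : Measurable f) (p : ℝ) (k : ℤ) :
    Measurable (scaleEnergy μ G f p k) :=
  ((measurable_localOscillation μ hG hf k).pow_const p).add
    ((measurable_dyadicMaximal μ (measurable_localOscillation μ hG hf k)).pow_const p)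

theorem lintegral_scaleEnergy_le {p : ℝ} (hp : 1 < p) (hG : MeasurableSet G) (hf : Measurable f)
    (k : ℤ) : ∫⁻ x, scaleEnergy μ G f p k x ∂μ ≤
      (1 + maximalConst μ p) * ∫⁻ x, localOscillation μ G f k x ^ p ∂μ := by
  have hT := measurable_localOscillation μ hG hf k
  unfold scaleEnergy
  rw [lintegral_add_left (hT.pow_const p), add_mul, one_mul]
  gcongr
  exact lintegral_dyadicMaximal_rpow_le μ hp hT

/-- The constant in the integral bound for the kernel. -/
noncomputable def kernelConst (ε : ℝ) : ℝ≥0∞ :=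
  2 ^ (finrank ℝ E - ε) * (μ (ball (0 : E) 1) * (dyadicConst ε + dyadicConst (finrank ℝ E - ε)))

theorem measurable_scaleMajorant (hG : MeasurableSet G) (hf : Measurable f) (p θ ε : ℝ) :
    Measurable fun q : E × E => scaleMajorant μ G f p θ ε q.1 q.2 := by
  refine Measurable.tsum fun k => Measurable.const_mul
    ((measurable_truncatedKernel _ k).mul (Measurable.add ?_ ?_)) _
  · exact (measurable_scaleEnergy μ hG hf p k).comp measurable_fst
  · exact (measurable_scaleEnergy μ hG hf p k).comp measurable_snd

theorem lintegral_scaleMajorant_le {p θ ε : ℝ} (hp : 1 < p) (hθ : 0 < θ) (hθp : θ ≤ p)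
    (hε : 0 < ε) (hε1 : ε < 1) (hd : 1 ≤ finrank ℝ E) (hG : MeasurableSet G) (hf : Measurable f) :
    ∫⁻ q, scaleMajorant μ G f p θ ε q.1 q.2 ∂(μ.prod μ) ≤
      2 * kernelConst μ ε * (1 + maximalConst μ p) *
        ((2 ^ (finrank ℝ E : ℝ) * μ (ball 0 1)) ^ (p - 1) * (2 * 2 ^ (finrank ℝ E + p))) *
      ∫⁻ u in G, ∫⁻ w in G, ‖f u - f w‖ₑ ^ p / ‖u - w‖ₑ ^ (finrank ℝ E + θ) ∂μ ∂μ := by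
  have hd1 : (1 : ℝ) ≤ finrank ℝ E := by exact_mod_cast hd
  set d : ℝ := (finrank ℝ E : ℝ) with hd_def
  have hK := fun k => measurable_truncatedKernel (E := E) (d - ε) k
  have hH := fun k => measurable_scaleEnergy μ hG hf p k
  have hKH1 : ∀ k : ℤ, Measurable fun q : E × E =>
      truncatedKernel (d - ε) k q.1 q.2 * scaleEnergy μ G f p k q.1 := fun k =>
    (hK k).mul ((hH k).comp measurable_fst)
  have hKH2 : ∀ k : ℤ, Measurable fun q : E × E =>
      truncatedKernel (d - ε) k q.1 q.2 * scaleEnergy μ G f p k q.2 := fun k =>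
    (hK k).mul ((hH k).comp measurable_snd)
  have hone : ∀ k : ℤ, ∀ x, ∫⁻ y, truncatedKernel (d - ε) k x y * scaleEnergy μ G f p k x ∂μ ≤
      kernelConst μ ε * (2 ^ k) ^ ε * scaleEnergy μ G f p k x := by
    intro k x
    have hKx : Measurable fun y => truncatedKernel (d - ε) k x y :=
      (hK k).comp measurable_prodMk_left
    rw [lintegral_mul_const _ hKx]
    exact mul_le_mul_left (lintegral_truncatedKernel_le μ (by linarith) hε (by ring) k x) _
  have hsum1 : ∀ k : ℤ, ∫⁻ q : E × E, truncatedKernel (d - ε) k q.1 q.2 *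
      scaleEnergy μ G f p k q.1 ∂(μ.prod μ) ≤
      kernelConst μ ε * (2 ^ k) ^ ε * ∫⁻ x, scaleEnergy μ G f p k x ∂μ := by
    intro k
    rw [lintegral_prod _ (hKH1 k).aemeasurable, ← lintegral_const_mul _ (hH k)]
    exact lintegral_mono fun x => hone k x
  have hsum2 : ∀ k : ℤ, ∫⁻ q : E × E, truncatedKernel (d - ε) k q.1 q.2 *
      scaleEnergy μ G f p k q.2 ∂(μ.prod μ) ≤
      kernelConst μ ε * (2 ^ k) ^ ε * ∫⁻ x, scaleEnergy μ G f p k x ∂μ := by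
    intro k
    rw [lintegral_prod_symm _ (hKH2 k).aemeasurable, ← lintegral_const_mul _ (hH k)]
    refine lintegral_mono fun x => ?_
    simp_rw [truncatedKernel_comm _ k _ x]
    exact hone k x
  have hKH : ∀ k : ℤ, Measurable fun q : E × E =>
      truncatedKernel (d - ε) k q.1 q.2 * scaleEnergy μ G f p k q.1 +
        truncatedKernel (d - ε) k q.1 q.2 * scaleEnergy μ G f p k q.2 := fun k =>
    (hKH1 k).add (hKH2 k)
  calc ∫⁻ q, scaleMajorant μ G f p θ ε q.1 q.2 ∂(μ.prod μ)
      = ∑' k : ℤ, (2 ^ k) ^ (-(ε + θ)) *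
          (∫⁻ q : E × E, truncatedKernel (d - ε) k q.1 q.2 * scaleEnergy μ G f p k q.1 ∂(μ.prod μ) +
          ∫⁻ q : E × E, truncatedKernel (d - ε) k q.1 q.2 *
            scaleEnergy μ G f p k q.2 ∂(μ.prod μ)) := by
        simp only [scaleMajorant, mul_add (truncatedKernel _ _ _ _), ← hd_def]
        rw [lintegral_tsum fun k => ((hKH k).const_mul _).aemeasurable]
        refine tsum_congr fun k => ?_
        rw [lintegral_const_mul _ (hKH k), lintegral_add_left (hKH1 k)]
    _ ≤ ∑' k : ℤ, 2 * kernelConst μ ε * (1 + maximalConst μ p) *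
          ((2 ^ k) ^ (-θ) * ∫⁻ x, localOscillation μ G f k x ^ p ∂μ) := by
        refine ENNReal.tsum_le_tsum fun k => ?_
        have h0 := ENNReal.two_zpow_ne_zero k
        have h1 := ENNReal.two_zpow_ne_top k
        calc _ ≤ ((2 : ℝ≥0∞) ^ k) ^ (-(ε + θ)) *
              (kernelConst μ ε * (2 ^ k) ^ ε * ∫⁻ x, scaleEnergy μ G f p k x ∂μ +
                kernelConst μ ε * (2 ^ k) ^ ε * ∫⁻ x, scaleEnergy μ G f p k x ∂μ) :=
              mul_le_mul_right (add_le_add (hsum1 k) (hsum2 k)) _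
          _ = (((2 : ℝ≥0∞) ^ k) ^ (-(ε + θ)) * (2 ^ k) ^ ε) *
              (2 * kernelConst μ ε * ∫⁻ x, scaleEnergy μ G f p k x ∂μ) := by ring
          _ ≤ ((2 : ℝ≥0∞) ^ k) ^ (-θ) * (2 * kernelConst μ ε * ((1 + maximalConst μ p) *
                ∫⁻ x, localOscillation μ G f k x ^ p ∂μ)) := by
              rw [← ENNReal.rpow_add _ _ h0 h1, show -(ε + θ) + ε = -θ by ring]
              gcongr
              exact lintegral_scaleEnergy_le μ hp hG hf k
          _ = _ := by ring
    _ ≤ 2 * kernelConst μ ε * (1 + maximalConst μ p) *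
          ((2 ^ d * μ (ball 0 1)) ^ (p - 1) * (dyadicConst (d + θ) * 2 ^ (d + θ)) *
          ∫⁻ u in G, ∫⁻ w in G, ‖f u - f w‖ₑ ^ p / ‖u - w‖ₑ ^ (d + θ) ∂μ ∂μ) := by
        rw [ENNReal.tsum_mul_left]
        exact mul_le_mul_right (tsum_lintegral_localOscillation_le μ hp hθ hG hf) _
    _ ≤ _ := by
        rw [← mul_assoc]
        gcongr
        -- The dependence on `θ` is removed here, using `d + θ ≥ 1` and `θ ≤ p`.
        · exact dyadicConst_le_two (by linarith)
        · exact one_le_two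

/-- The constant in the integral bound for the majorant. -/
noncomputable def majorantConst (p ε : ℝ) : ℝ≥0∞ :=
  1 + maximalConst μ p + maximalConst μ p + 2 * kernelConst μ ε * (1 + maximalConst μ p) *
    ((2 ^ (finrank ℝ E : ℝ) * μ (ball (0 : E) 1)) ^ (p - 1) * (2 * 2 ^ (finrank ℝ E + p)))

theorem majorantConst_ne_top {p ε : ℝ} (hp : 1 < p) (hε : 0 < ε) (hε1 : ε < 1)
    (hd : 1 ≤ finrank ℝ E) : majorantConst μ p ε ≠ ∞ := by
  have hd1 : (1 : ℝ) ≤ finrank ℝ E := by exact_mod_cast hd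
  have hω : μ (ball (0 : E) 1) ≠ ∞ := measure_ball_lt_top.ne
  have hm := maximalConst_ne_top μ hp
  have h2 : ∀ {a : ℝ}, 0 ≤ a → (2 : ℝ≥0∞) ^ a ≠ ∞ := fun ha =>
    ENNReal.rpow_ne_top_of_nonneg ha ENNReal.ofNat_ne_top
  have hk : kernelConst μ ε ≠ ∞ := ENNReal.mul_ne_top (h2 (by linarith))
    (ENNReal.mul_ne_top hω (ENNReal.add_ne_top.2
      ⟨dyadicConst_ne_top hε, dyadicConst_ne_top (by linarith)⟩))
  refine ENNReal.add_ne_top.2 ⟨ENNReal.add_ne_top.2 ⟨ENNReal.add_ne_top.2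
    ⟨ENNReal.one_ne_top, hm⟩, hm⟩, ENNReal.mul_ne_top (ENNReal.mul_ne_top
      (ENNReal.mul_ne_top ENNReal.ofNat_ne_top hk)
      (ENNReal.add_ne_top.2 ⟨ENNReal.one_ne_top, hm⟩)) (ENNReal.mul_ne_top
      (ENNReal.rpow_ne_top_of_nonneg (by linarith) (ENNReal.mul_ne_top (h2 (by linarith)) hω))
      (ENNReal.mul_ne_top ENNReal.ofNat_ne_top (h2 (by linarith))))⟩

theorem lintegral_majorant_le {p θ ε : ℝ} (hp : 1 < p) (hθ : 0 < θ) (hθp : θ ≤ p)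
    (hε : 0 < ε) (hε1 : ε < 1) (hd : 1 ≤ finrank ℝ E) (hG : MeasurableSet G) (hf : Measurable f) :
    ∫⁻ x, ∫⁻ y, majorant μ G f p θ ε x y ∂μ ∂μ ≤ majorantConst μ p ε *
      ∫⁻ u in G, ∫⁻ w in G, ‖f u - f w‖ₑ ^ p / ‖u - w‖ₑ ^ (finrank ℝ E + θ) ∂μ ∂μ := by
  have hp0 : 0 < p := by linarith
  set γ := ((finrank ℝ E : ℝ) + θ) / p with hγ
  set W := ∫⁻ u in G, ∫⁻ w in G, ‖f u - f w‖ₑ ^ p / ‖u - w‖ₑ ^ ((finrank ℝ E : ℝ) + θ) ∂μ ∂μ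
  have hQ := measurable_diffQuotient hG hf γ
  have hW : ∫⁻ x, ∫⁻ y, diffQuotient G f γ x y ^ p ∂μ ∂μ = W := by
    rw [lintegral_diffQuotient_rpow μ hp0 hG, hγ, div_mul_cancel₀ _ hp0.ne']
  have hM := measurable_dyadicMaximal_prod μ hQ
  have hm1 : Measurable fun q : E × E => diffQuotient G f γ q.1 q.2 ^ p := hQ.pow_const p
  have hm3 : Measurable fun q : E × E => dyadicMaximal μ (diffQuotient G f γ q.1) q.2 ^ p :=
    hM.pow_const p
  have hm2 : Measurable fun q : E × E => dyadicMaximal μ (diffQuotient G f γ q.2) q.1 ^ p := by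
    simpa only [Function.comp_def, Prod.fst_swap, Prod.snd_swap] using hm3.comp measurable_swap
  have hm4 := measurable_scaleMajorant μ hG hf p θ ε
  have hmax : ∫⁻ x, ∫⁻ y, dyadicMaximal μ (diffQuotient G f γ x) y ^ p ∂μ ∂μ ≤
      maximalConst μ p * W := by
    rw [← hW, ← lintegral_const_mul' _ _ (maximalConst_ne_top μ hp)]
    exact lintegral_mono fun x =>
      lintegral_dyadicMaximal_rpow_le μ hp hQ.of_uncurry_left
  simp only [majorant, ← hγ]
  have hm : Measurable fun q : E × E => diffQuotient G f γ q.1 q.2 ^ p +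
      dyadicMaximal μ (diffQuotient G f γ q.2) q.1 ^ p +
      dyadicMaximal μ (diffQuotient G f γ q.1) q.2 ^ p + scaleMajorant μ G f p θ ε q.1 q.2 :=
    ((hm1.add hm2).add hm3).add hm4
  rw [← lintegral_prod (fun q : E × E => diffQuotient G f γ q.1 q.2 ^ p +
      dyadicMaximal μ (diffQuotient G f γ q.2) q.1 ^ p +
      dyadicMaximal μ (diffQuotient G f γ q.1) q.2 ^ p + scaleMajorant μ G f p θ ε q.1 q.2)
      hm.aemeasurable]
  -- Each maximal function must be integrated first in the point where it is evaluated, hence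
  -- `lintegral_prod_symm` for the second term only.
  rw [lintegral_add_right _ hm4, lintegral_add_right _ hm3, lintegral_add_right _ hm2,
    lintegral_prod _ hm1.aemeasurable, lintegral_prod_symm _ hm2.aemeasurable,
    lintegral_prod _ hm3.aemeasurable, hW, majorantConst, add_mul, add_mul, add_mul, one_mul]
  gcongr
  exact lintegral_scaleMajorant_le μ hp hθ hθp hε hε1 hd hG hf

/-- Only the `k`-th term of the sum is kept: `|x - y| ≤ 2 ^ k` makes its kernel active, and `2 ^ k ≤
2ρ` lets the weight in `ρ` absorb `2 ^ (k(ε + θ))`. -/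
theorem le_scaleMajorant {p θ ε : ℝ} (hθ : 0 < θ) (hε : 0 < ε) {x y : E} (hxy : x ≠ y) {k : ℤ}
    {ρ : ℝ≥0∞} (hk : ‖x - y‖ₑ ≤ 2 ^ k) (hkρ : 2 ^ k ≤ 2 * ρ) {h : ℝ≥0∞}
    (hh : h ≤ scaleEnergy μ G f p k x + scaleEnergy μ G f p k y) :
    h ≤ 2 ^ (ε + θ) * (ρ ^ (ε + θ) * ‖x - y‖ₑ ^ (finrank ℝ E - ε)) *
      scaleMajorant μ G f p θ ε x y := by
  have h0 : ‖x - y‖ₑ ≠ 0 := by simpa [sub_eq_zero] using hxy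
  have hk0 := ENNReal.two_zpow_ne_zero k
  have hk1 := ENNReal.two_zpow_ne_top k
  have hεθ : 0 ≤ ε + θ := by linarith
  set d : ℝ := (finrank ℝ E : ℝ)
  set S := scaleEnergy μ G f p k x + scaleEnergy μ G f p k y
  calc h ≤ S := hh
    _ = (((2 : ℝ≥0∞) ^ k) ^ (-(ε + θ)) * (2 ^ k) ^ (ε + θ)) *
        (‖x - y‖ₑ ^ (-(d - ε)) * ‖x - y‖ₑ ^ (d - ε)) * S := by
        rw [ENNReal.rpow_neg_mul_rpow hk0 hk1, ENNReal.rpow_neg_mul_rpow h0 enorm_ne_top,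
          one_mul, one_mul]
    _ ≤ (((2 : ℝ≥0∞) ^ k) ^ (-(ε + θ)) * (2 * ρ) ^ (ε + θ)) *
        (‖x - y‖ₑ ^ (-(d - ε)) * ‖x - y‖ₑ ^ (d - ε)) * S := by gcongr
    _ = 2 ^ (ε + θ) * (ρ ^ (ε + θ) * ‖x - y‖ₑ ^ (d - ε)) *
        ((2 ^ k) ^ (-(ε + θ)) * (truncatedKernel (d - ε) k x y * S)) := by
        rw [truncatedKernel, if_pos hk, ENNReal.mul_rpow_of_nonneg _ _ hεθ]
        ring
    _ ≤ _ := by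
        gcongr
        exact ENNReal.le_tsum k

/-- The constant in the pointwise bound by the majorant. -/
noncomputable def pointwiseConst (p : ℝ) : ℝ≥0∞ :=
  1 + ((μ (ball (0 : E) 1))⁻¹ * 2 ^ (finrank ℝ E : ℝ)) ^ p * 2 ^ (finrank ℝ E + p) +
    (((μ (ball (0 : E) 1))⁻¹ * 2 ^ (finrank ℝ E : ℝ)) ^ p +
      (((μ (ball (0 : E) 1))⁻¹ * 2 ^ (finrank ℝ E : ℝ)) ^ 2) ^ p * 2 ^ (p - 1)) * 2 ^ (1 + p)

theorem pointwiseConst_ne_top {p : ℝ} (hp : 1 < p) : pointwiseConst μ p ≠ ∞ := by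
  have hd : (0 : ℝ) ≤ finrank ℝ E := Nat.cast_nonneg _
  have h2 : ∀ {a : ℝ}, 0 ≤ a → (2 : ℝ≥0∞) ^ a ≠ ∞ := fun ha =>
    ENNReal.rpow_ne_top_of_nonneg ha ENNReal.ofNat_ne_top
  have hA : (μ (ball (0 : E) 1))⁻¹ * 2 ^ (finrank ℝ E : ℝ) ≠ ∞ := ENNReal.mul_ne_top
    (ENNReal.inv_ne_top.2 (measure_ball_pos μ 0 one_pos).ne') (h2 hd)
  have hp0 : 0 ≤ p := by linarith
  have hAp := ENNReal.rpow_ne_top_of_nonneg hp0 hA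
  have hAp2 := ENNReal.rpow_ne_top_of_nonneg hp0 (ENNReal.pow_ne_top (n := 2) hA)
  exact ENNReal.add_ne_top.2 ⟨ENNReal.add_ne_top.2 ⟨ENNReal.one_ne_top,
    ENNReal.mul_ne_top hAp (h2 (by linarith))⟩, ENNReal.mul_ne_top (ENNReal.add_ne_top.2
      ⟨hAp, ENNReal.mul_ne_top hAp2 (h2 (by linarith))⟩) (h2 (by linarith))⟩

end Majorant

/-! ### The pointwise comparison of averages at two points. -/

/-- Every mean over a ball at `x` is controlled by a mean over a smaller ball at `y`. -/
theorem ballAverage_le_ballAverage_add {n : ℕ} {G : Set (EuclideanSpace ℝ (Fin n))}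
    {f : EuclideanSpace ℝ (Fin n) → ℝ} {p θ ε : ℝ} (hp : 1 < p) (hθ : 0 < θ) (hθp : θ ≤ p)
    (hε : 0 < ε) (hε1 : ε < 1) (hG : MeasurableSet G) (hf : Measurable f)
    {x y : EuclideanSpace ℝ (Fin n)} (hxy : x ≠ y) (hx : x ∈ G) (hy : y ∈ G) {r ρ : ℝ}
    (hr : 0 ≤ r) (hball : ball x r ⊆ G) (hρ : dist x y ≤ ρ) :
    ∃ r', 0 ≤ r' ∧ r' ≤ max 0 (r - ρ) ∧ ballAverage f x r ≤ ballAverage f y r' +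
      (pointwiseConst (volume : Measure (EuclideanSpace ℝ (Fin n))) p *
        (ENNReal.ofReal ρ ^ (ε + θ) * ‖x - y‖ₑ ^ (n - ε)) *
        majorant volume G f p θ ε x y) ^ p⁻¹ := by
  have hdn : Module.finrank ℝ (EuclideanSpace ℝ (Fin n)) = n := finrank_euclideanSpace_fin
  have hp0 : 0 < p := by linarith
  have hεθ : 0 ≤ ε + θ := by linarith
  have h0 : ‖x - y‖ₑ ≠ 0 := by simpa [sub_eq_zero] using hxy
  have hdist : 0 < dist x y := dist_pos.2 hxy
  have hρ0 : 0 < ρ := hdist.trans_le hρ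
  have hedist : ‖x - y‖ₑ = ENNReal.ofReal (dist x y) := by rw [dist_eq_norm, ofReal_norm]
  set A := (volume (ball (0 : EuclideanSpace ℝ (Fin n)) 1))⁻¹ * 2 ^ (n : ℝ) with hA
  have hC : pointwiseConst (volume : Measure (EuclideanSpace ℝ (Fin n))) p =
      1 + A ^ p * 2 ^ (n + p) + (A ^ p + (A ^ 2) ^ p * 2 ^ (p - 1)) * 2 ^ (1 + p) := by
    rw [pointwiseConst, hdn]
  set C := pointwiseConst (volume : Measure (EuclideanSpace ℝ (Fin n))) p
  set D := ENNReal.ofReal ρ ^ (ε + θ) * ‖x - y‖ₑ ^ (n - ε) with hD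
  set γ := (n + θ) / p with hγ
  have hγ0 : 0 ≤ γ := by positivity
  have hγp : γ * p = n + θ := div_mul_cancel₀ _ hp0.ne'
  have hmaj : majorant volume G f p θ ε x y = diffQuotient G f γ x y ^ p +
      dyadicMaximal volume (diffQuotient G f γ y) x ^ p +
      dyadicMaximal volume (diffQuotient G f γ x) y ^ p +
      scaleMajorant volume G f p θ ε x y := by
    rw [majorant, hdn]
  set Ψ := majorant volume G f p θ ε x y
  -- Since `|x - y| ≤ ρ`, the weight `D` dominates the power of `|x - y|` that the difference
  -- quotient terms require.
  have hDle : ‖x - y‖ₑ ^ (n + θ) ≤ D := by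
    rw [show (n : ℝ) + θ = (ε + θ) + (n - ε) by ring, ENNReal.rpow_add _ _ h0 enorm_ne_top, hD,
      hedist]
    gcongr
  have hscale : ∀ {k : ℤ} {h : ℝ≥0∞}, dist x y ≤ 2 ^ k → (2 : ℝ) ^ k ≤ 2 * ρ →
      h ≤ scaleEnergy volume G f p k x + scaleEnergy volume G f p k y →
      h ≤ 2 ^ (1 + p) * (D * Ψ) := by
    intro k h hk hkρ hh
    have h1 : ‖x - y‖ₑ ≤ 2 ^ k := by
      rw [hedist, ← ENNReal.ofReal_two_zpow]
      exact ENNReal.ofReal_le_ofReal hk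
    have h2 : (2 : ℝ≥0∞) ^ k ≤ 2 * ENNReal.ofReal ρ := by
      rw [← ENNReal.ofReal_two_zpow, ← ENNReal.ofReal_ofNat, ← ENNReal.ofReal_mul (by norm_num)]
      exact ENNReal.ofReal_le_ofReal hkρ
    have h3 := le_scaleMajorant volume hθ hε hxy h1 h2 hh
    rw [hdn] at h3
    refine h3.trans ?_
    rw [mul_assoc]
    gcongr
    · exact one_le_two
    · rw [hmaj]
      exact le_add_self
  rcases hr.eq_or_lt with rfl | hr0
  · refine ⟨0, le_rfl, le_max_left _ _, ?_⟩
    simp only [ballAverage, if_true]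
    refine (enorm_le_enorm_add_enorm_sub _ (f y)).trans (add_le_add_right ?_ _)
    rw [ENNReal.le_rpow_inv_iff hp0]
    calc ‖f x - f y‖ₑ ^ p ≤ (diffQuotient G f γ x y * ‖x - y‖ₑ ^ γ) ^ p := by
          gcongr
          exact enorm_sub_le_diffQuotient hγ0 hx hy
      _ = ‖x - y‖ₑ ^ (n + θ) * diffQuotient G f γ x y ^ p := by
          rw [ENNReal.mul_rpow_of_nonneg _ _ hp0.le, ← ENNReal.rpow_mul, hγp, mul_comm]
      _ ≤ D * Ψ := by
          gcongr
          rw [hmaj, add_assoc, add_assoc]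
          exact le_self_add
      _ = 1 * D * Ψ := by rw [one_mul]
      _ ≤ C * D * Ψ := by
          gcongr
          rw [hC, add_assoc]
          exact le_self_add
  rcases le_or_gt r ρ with hrρ | hrρ
  -- For `r ≤ ρ` the comparison is with the value `|f y|`, the average of radius `0`.
  · refine ⟨0, le_rfl, le_max_left _ _, ?_⟩
    simp only [ballAverage, if_true, if_neg hr0.ne']
    rcases le_total r (dist x y) with hrd | hrd
    · refine (laverage_ball_le_of_le_dist volume hγ0 hr0 hrd hy hball).trans
        (add_le_add_right ?_ _)
      rw [ENNReal.le_rpow_inv_iff hp0, hdn, ← hA]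
      set M := dyadicMaximal volume (diffQuotient G f γ y) x
      calc (A * (2 * ‖x - y‖ₑ) ^ γ * M) ^ p
          = A ^ p * 2 ^ (n + θ) * (‖x - y‖ₑ ^ (n + θ) * M ^ p) := by
            rw [ENNReal.mul_rpow_of_nonneg _ _ hp0.le, ENNReal.mul_rpow_of_nonneg _ _ hp0.le,
              ← ENNReal.rpow_mul, hγp, ENNReal.mul_rpow_of_nonneg 2 _ (by positivity)]
            ring
        _ ≤ A ^ p * 2 ^ (n + p) * (D * Ψ) := by
            gcongr
            · exact one_le_two
            · rw [hmaj, add_assoc, add_assoc, add_left_comm]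
              exact le_self_add
        _ ≤ C * (D * Ψ) := by
            gcongr
            rw [hC, add_assoc, add_left_comm]
            exact le_self_add
        _ = _ := (mul_assoc _ _ _).symm
    -- The scale is adapted to `r`, not to `ρ`: it satisfies `|x - y| ≤ r ≤ 2 ^ (m + 1) < 2 * r ≤ 2
    -- * ρ`, as `hscale` demands.
    · obtain ⟨m, hm1, hm2⟩ := exists_mem_Ioc_zpow hr0 one_lt_two
      have hk : (2 : ℝ) ^ (m + 1) ≤ 2 * r := by
        rw [zpow_add₀ two_ne_zero, zpow_one]
        linarith
      refine (laverage_ball_le_of_dist_le volume hr0 hk hm2 hrd hy hball).trans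
        (add_le_add_right ?_ _)
      rw [ENNReal.le_rpow_inv_iff hp0, hdn, ← hA, ENNReal.mul_rpow_of_nonneg _ _ hp0.le]
      calc A ^ p * localOscillation volume G f (m + 1) y ^ p
          ≤ A ^ p * (2 ^ (1 + p) * (D * Ψ)) := by
            gcongr
            exact hscale (hrd.trans hm2) (hk.trans (by linarith))
              ((le_self_add (b := dyadicMaximal _ _ _ ^ p)).trans le_add_self)
        _ = A ^ p * 2 ^ (1 + p) * (D * Ψ) := by ring
        _ ≤ C * (D * Ψ) := by
            gcongr
            rw [hC, add_mul]
            exact le_self_add.trans le_add_self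
        _ = _ := (mul_assoc _ _ _).symm
  · refine ⟨r - ρ, by linarith, le_max_right _ _, ?_⟩
    simp only [ballAverage, if_neg hr0.ne', if_neg (sub_pos.2 hrρ).ne']
    obtain ⟨m, hm1, hm2⟩ := exists_mem_Ioc_zpow hρ0 one_lt_two
    have hk : (2 : ℝ) ^ (m + 1) ≤ 2 * ρ := by
      rw [zpow_add₀ two_ne_zero, zpow_one]
      linarith
    refine (laverage_ball_le_laverage_ball_add volume hG hf hρ0 hrρ hk hm2 hρ hball).trans
      (add_le_add_right ?_ _)
    rw [ENNReal.le_rpow_inv_iff hp0, hdn, ← hA, ENNReal.mul_rpow_of_nonneg _ _ hp0.le]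
    set a := dyadicMaximal volume (localOscillation volume G f (m + 1)) x
    set b := dyadicMaximal volume (localOscillation volume G f (m + 1)) y
    calc (A ^ 2) ^ p * (a + b) ^ p ≤ (A ^ 2) ^ p * (2 ^ (p - 1) * (a ^ p + b ^ p)) := by
          gcongr
          exact ENNReal.rpow_add_le_mul_rpow_add_rpow _ _ hp.le
      _ ≤ (A ^ 2) ^ p * (2 ^ (p - 1) * (2 ^ (1 + p) * (D * Ψ))) := by
          gcongr
          exact hscale (hρ.trans hm2) hk (add_le_add le_add_self le_add_self)
      _ = (A ^ 2) ^ p * 2 ^ (p - 1) * 2 ^ (1 + p) * (D * Ψ) := by ring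
      _ ≤ C * (D * Ψ) := by
          gcongr
          rw [hC, add_mul]
          exact le_add_self.trans le_add_self
      _ = _ := (mul_assoc _ _ _).symm

/-! ### The local maximal function: measurability, finiteness and differences. -/

theorem ball_subset_of_le_infEDist_frontier {E : Type*} [NormedAddCommGroup E] [NormedSpace ℝ E]
    {G : Set E} (hG : IsOpen G) {x : E} (hx : x ∈ G) {r : ℝ}
    (hr : ENNReal.ofReal r ≤ Metric.infEDist x (frontier G)) : ball x r ⊆ G := by
  rcases le_or_gt r 0 with h | h
  · simp [ball_eq_empty.2 h]
  -- The ball is connected and misses the boundary, so it cannot meet both `G` and the exterior of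
  -- `G`.
  refine (convex_ball x r).isPreconnected.subset_left_of_subset_union hG
    (isClosed_closure (s := G)).isOpen_compl ?_ ?_ ⟨x, mem_ball_self h, hx⟩
  · exact disjoint_compl_right.mono_left subset_closure
  · intro z hz
    by_contra hzG
    have hzG' : z ∉ G ∧ z ∈ closure G := by simpa using hzG
    have hzf : z ∈ frontier G := by
      rw [hG.frontier_eq]
      exact ⟨hzG'.2, hzG'.1⟩
    have h1 : ENNReal.ofReal r ≤ edist x z := hr.trans (Metric.infEDist_le_edist_of_mem hzf)
    rw [edist_dist, ENNReal.ofReal_le_ofReal_iff dist_nonneg, dist_comm] at h1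
    exact absurd hz (not_lt.2 h1)

theorem enorm_toReal_sub_toReal_le {a b c : ℝ≥0∞} (ha : a ≠ ∞) (hb : b ≠ ∞) (hab : a ≤ b + c)
    (hba : b ≤ a + c) : ‖a.toReal - b.toReal‖ₑ ≤ c := by
  rcases eq_or_ne c ∞ with rfl | hc
  · exact le_top
  have h1 := ENNReal.toReal_mono (ENNReal.add_ne_top.2 ⟨hb, hc⟩) hab
  have h2 := ENNReal.toReal_mono (ENNReal.add_ne_top.2 ⟨ha, hc⟩) hba
  rw [ENNReal.toReal_add hb hc] at h1
  rw [ENNReal.toReal_add ha hc] at h2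
  rw [Real.enorm_eq_ofReal_abs]
  exact ENNReal.ofReal_le_of_le_toReal (abs_le.2 ⟨by linarith, by linarith⟩)

section LocalMaximal

variable {n : ℕ} {G : Set (EuclideanSpace ℝ (Fin n))} {R f g : EuclideanSpace ℝ (Fin n) → ℝ}

theorem IsAdmissibleRadius.ball_subset (hR : IsAdmissibleRadius G R) (hG : IsOpen G)
    {x : EuclideanSpace ℝ (Fin n)} (hx : x ∈ G) {r : ℝ} (hr : r ≤ R x) : ball x r ⊆ G :=
  ball_subset_of_le_infEDist_frontier hG hx
    ((ENNReal.ofReal_le_ofReal hr).trans (hR.le_dist x hx))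

/-- Almost everywhere equality takes care of positive radii only; the radius `0` needs equality at
`x` itself. -/
theorem maximalR_congr (hR : IsAdmissibleRadius G R) (hG : IsOpen G)
    (hfg : ∀ᵐ x ∂(volume.restrict G), f x = g x) {x : EuclideanSpace ℝ (Fin n)} (hx : x ∈ G)
    (hfx : f x = g x) : maximalR R f x = maximalR R g x := by
  refine iSup_congr fun r => iSup_congr fun hr => ?_
  unfold ballAverage
  split_ifs with h
  · rw [hfx]
  · refine laverage_congr ?_
    filter_upwards [ae_restrict_of_ae_restrict_of_subset (hR.ball_subset hG hx hr.2) hfg]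
      with y hy
    rw [hy]

theorem maximalR_le_dyadicMaximal (R f : EuclideanSpace ℝ (Fin n) → ℝ)
    (x : EuclideanSpace ℝ (Fin n)) :
    maximalR R f x ≤ ‖f x‖ₑ + (volume (ball (0 : EuclideanSpace ℝ (Fin n)) 1))⁻¹ *
      2 ^ (Module.finrank ℝ (EuclideanSpace ℝ (Fin n)) : ℝ) *
        dyadicMaximal volume (fun y => ‖f y‖ₑ) x := by
  refine iSup₂_le fun r hr => ?_
  unfold ballAverage
  split_ifs with h
  · exact le_self_add
  · exact (laverage_ball_le_dyadicMaximal volume _ x (lt_of_le_of_ne hr.1 (Ne.symm h))).trans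
      le_add_self

theorem maximalR_ae_lt_top {p : ℝ} (hp : 1 < p) (hf : Measurable f)
    (hfp : ∫⁻ x, ‖f x‖ₑ ^ p < ∞) : ∀ᵐ x, maximalR R f x < ∞ := by
  have hfm : Measurable fun y => ‖f y‖ₑ := hf.enorm
  have hM := measurable_dyadicMaximal volume hfm
  have hfin : ∫⁻ x, dyadicMaximal volume (fun y => ‖f y‖ₑ) x ^ p ≠ ∞ :=
    ne_top_of_le_ne_top (ENNReal.mul_ne_top (maximalConst_ne_top volume hp) hfp.ne)
      (lintegral_dyadicMaximal_rpow_le volume hp hfm)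
  filter_upwards [ae_lt_top (hM.pow_const p) hfin] with x hx
  refine (maximalR_le_dyadicMaximal R f x).trans_lt (ENNReal.add_lt_top.2 ⟨enorm_lt_top, ?_⟩)
  refine ENNReal.mul_lt_top (ENNReal.mul_lt_top
    (ENNReal.inv_lt_top.2 (measure_ball_pos volume 0 one_pos)) ?_) ?_
  · exact ENNReal.rpow_lt_top_of_nonneg (Nat.cast_nonneg _) ENNReal.ofNat_ne_top
  · exact (ENNReal.rpow_lt_top_iff_of_pos (by linarith)).1 hx

theorem measurable_laverage_ball (hf : Measurable f) (r : ℝ) :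
    Measurable fun x : EuclideanSpace ℝ (Fin n) => ⨍⁻ y in ball x r, ‖f y‖ₑ ∂volume := by
  rcases le_or_gt r 0 with h | h
  · simp [ball_eq_empty.2 h]
  simp_rw [laverage_ball_eq volume (fun y => ‖f y‖ₑ) _ h]
  refine Measurable.const_mul ?_ _
  exact Measurable.lintegral_prod_right' (ν := volume.restrict (ball 0 1))
    (f := fun q : EuclideanSpace ℝ (Fin n) × EuclideanSpace ℝ (Fin n) => ‖f (q.1 + r • q.2)‖ₑ)
    (by fun_prop)

theorem setLIntegral_ball_eq_iSup_rat (g : EuclideanSpace ℝ (Fin n) → ℝ≥0∞)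
    (x : EuclideanSpace ℝ (Fin n)) (r : ℝ) :
    ∫⁻ y in ball x r, g y = ⨆ q : {q : ℚ // (q : ℝ) < r}, ∫⁻ y in ball x (q : ℚ), g y := by
  have hU : ball x r = ⋃ q : {q : ℚ // (q : ℝ) < r}, ball x (q : ℚ) := by
    ext y
    simp only [mem_ball, mem_iUnion, Subtype.exists, exists_prop]
    refine ⟨fun h => ?_, fun ⟨q, hq, h⟩ => h.trans hq⟩
    obtain ⟨q, h1, h2⟩ := exists_rat_btwn h
    exact ⟨q, h2, h1⟩
  have hd : Directed (· ⊆ ·) fun q : {q : ℚ // (q : ℝ) < r} => ball x ((q : ℚ) : ℝ) :=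
    Monotone.directed_le fun a b h => ball_subset_ball (by exact_mod_cast h)
  rw [hU, setLIntegral_iUnion_of_directed _ hd]

/-- The local maximal function as a countable supremum. -/
theorem maximalR_eq_sup_iSup_rat {x : EuclideanSpace ℝ (Fin n)} (hx : 0 ≤ R x) :
    maximalR R f x = ‖f x‖ₑ ⊔ ⨆ q : ℚ, if 0 < (q : ℝ) ∧ (q : ℝ) < R x then
      ⨍⁻ y in ball x q, ‖f y‖ₑ ∂volume else 0 := by
  set S := ⨆ q : ℚ, if 0 < (q : ℝ) ∧ (q : ℝ) < R x then ⨍⁻ y in ball x q, ‖f y‖ₑ ∂volume else 0 with hS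
  apply le_antisymm
  · refine iSup₂_le fun r hr => ?_
    unfold ballAverage
    split_ifs with h
    · exact le_sup_left
    · refine le_trans ?_ le_sup_right
      have hr0 : 0 < r := lt_of_le_of_ne hr.1 (Ne.symm h)
      rw [setLAverage_eq, setLIntegral_ball_eq_iSup_rat, ENNReal.iSup_div]
      -- An open ball is exhausted by concentric balls of rational radius `q < r`. Replacing
      -- `|B(x,r)|` by the smaller `|B(x,q)|` only increases the quotient, so strict inequality `q <
      -- R x` loses nothing.
      refine iSup_le fun ⟨q, hq⟩ => ?_
      rcases le_or_gt (q : ℝ) 0 with hq0 | hq0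
      · simp [ball_eq_empty.2 hq0]
      · calc _ ≤ ⨍⁻ y in ball x q, ‖f y‖ₑ ∂volume := by
              rw [setLAverage_eq]
              exact ENNReal.div_le_div_left (measure_mono (ball_subset_ball hq.le)) _
          _ ≤ S := by
              refine le_trans ?_ (le_iSup _ q)
              rw [if_pos ⟨hq0, hq.trans_le hr.2⟩]
  · refine sup_le ?_ (iSup_le fun q => ?_)
    · refine le_trans ?_ (le_iSup₂ (f := fun r (_ : 0 ≤ r ∧ r ≤ R x) => ballAverage f x r) 0
        ⟨le_rfl, hx⟩)
      simp [ballAverage]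
    · split_ifs with h
      · refine le_trans ?_ (le_iSup₂ (f := fun r (_ : 0 ≤ r ∧ r ≤ R x) => ballAverage f x r)
          (q : ℝ) ⟨h.1.le, h.2.le⟩)
        rw [ballAverage, if_neg h.1.ne']
      · exact zero_le

theorem aemeasurable_maximalR (hR : IsAdmissibleRadius G R) (hG : MeasurableSet G)
    (hf : Measurable f) : AEMeasurable (maximalR R f) (volume.restrict G) := by
  obtain ⟨R', hR'm, hR'⟩ := hR.measurable
  refine ⟨fun x => ‖f x‖ₑ ⊔ ⨆ q : ℚ, if 0 < (q : ℝ) ∧ (q : ℝ) < R' x then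
      ⨍⁻ y in ball x q, ‖f y‖ₑ ∂volume else 0, ?_, ?_⟩
  · refine hf.enorm.sup (Measurable.iSup fun q => Measurable.ite ?_
      (measurable_laverage_ball hf q) measurable_const)
    exact (MeasurableSet.const _).inter (measurableSet_lt measurable_const hR'm)
  · filter_upwards [hR', ae_restrict_mem hG] with x hx hxG
    rw [maximalR_eq_sup_iSup_rat (hR.nonneg x hxG), hx]

/-- The choice `ρ = |x - y| + |R x - R y|` makes `r - ρ ≤ R y` whenever `r ≤ R x`. This explains the
shape of the denominator and why no regularity of `R` is needed. -/
theorem maximalR_le_maximalR_add {p θ ε : ℝ} (hp : 1 < p) (hθ : 0 < θ) (hθp : θ ≤ p)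
    (hε : 0 < ε) (hε1 : ε < 1) (hR : IsAdmissibleRadius G R) (hG : IsOpen G) (hf : Measurable f)
    {x y : EuclideanSpace ℝ (Fin n)} (hxy : x ≠ y) (hx : x ∈ G) (hy : y ∈ G) :
    maximalR R f x ≤ maximalR R f y +
      (pointwiseConst (volume : Measure (EuclideanSpace ℝ (Fin n))) p *
        ((‖x - y‖ₑ + ‖R x - R y‖ₑ) ^ (ε + θ) * ‖x - y‖ₑ ^ (n - ε)) *
        majorant volume G f p θ ε x y) ^ p⁻¹ := by
  refine iSup₂_le fun r hr => ?_
  obtain ⟨r', h0, h1, h2⟩ := ballAverage_le_ballAverage_add hp hθ hθp hε hε1 hG.measurableSet hf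
    hxy hx hy hr.1 (hR.ball_subset hG hx hr.2)
    (le_add_of_nonneg_right (abs_nonneg (R x - R y)))
  have hρ : ENNReal.ofReal (dist x y + |R x - R y|) = ‖x - y‖ₑ + ‖R x - R y‖ₑ := by
    rw [ENNReal.ofReal_add dist_nonneg (abs_nonneg _), dist_eq_norm, ofReal_norm,
      Real.enorm_eq_ofReal_abs]
  rw [hρ] at h2
  refine h2.trans (add_le_add_left ?_ _)
  refine le_iSup₂ (f := fun r (_ : 0 ≤ r ∧ r ≤ R y) => ballAverage f y r) r' ⟨h0, h1.trans ?_⟩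
  refine max_le (hR.nonneg y hy) ?_
  have := le_abs_self (R x - R y)
  have := dist_nonneg (x := x) (y := y)
  linarith [hr.2]

theorem maximalR_diffQuotient_le {p θ ε : ℝ} (hp : 1 < p) (hθ : 0 < θ) (hθp : θ ≤ p)
    (hε : 0 < ε) (hε1 : ε < 1) (hR : IsAdmissibleRadius G R) (hG : IsOpen G) (hf : Measurable f)
    {x y : EuclideanSpace ℝ (Fin n)} (hx : x ∈ G) (hy : y ∈ G) (hfx : maximalR R f x < ∞)
    (hfy : maximalR R f y < ∞) :
    ‖(maximalR R f x).toReal - (maximalR R f y).toReal‖ₑ ^ p /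
        ((‖x - y‖ₑ + ‖R x - R y‖ₑ) ^ (ε + θ) * ‖x - y‖ₑ ^ (n - ε)) ≤
      pointwiseConst (volume : Measure (EuclideanSpace ℝ (Fin n))) p *
        majorant volume G f p θ ε x y := by
  have hp0 : 0 < p := by linarith
  rcases eq_or_ne x y with rfl | hxy
  · simp [hp0]
  refine ENNReal.div_le_of_le_mul ?_
  rw [← ENNReal.le_rpow_inv_iff hp0]
  have h1 := maximalR_le_maximalR_add hp hθ hθp hε hε1 hR hG hf hxy hx hy
  have h2 := maximalR_le_maximalR_add hp hθ hθp hε hε1 hR hG hf hxy.symm hy hx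
  rw [← enorm_neg (y - x), ← enorm_neg (R y - R x), neg_sub, neg_sub, majorant_comm] at h2
  rw [mul_right_comm] at h1 h2
  exact enorm_toReal_sub_toReal_le hfx.ne hfy.ne h1 h2

end LocalMaximal

/-! ### The main theorem. -/

theorem theorem1p1 (n : ℕ) (hn : 1 ≤ n) (p ε : ℝ) (hp : 1 < p) (hε0 : 0 < ε) (hε1 : ε < 1) :
    ∃ C : ℝ, 0 < C ∧
      ∀ (s : ℝ), 0 < s → s < 1 →
      ∀ (G : Set (EuclideanSpace ℝ (Fin n))), IsOpen G → G.Nonempty →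
      ∀ (R : EuclideanSpace ℝ (Fin n) → ℝ), IsAdmissibleRadius G R →
      ∀ (f : EuclideanSpace ℝ (Fin n) → ℝ), MemLp f (ENNReal.ofReal p) (volume.restrict G) →
        AEMeasurable (maximalR R f) (volume.restrict G) ∧
        (∀ᵐ x ∂(volume.restrict G), maximalR R f x < ∞) ∧
        (∫⁻ x in G, ∫⁻ y in G,
            ‖(maximalR R f x).toReal - (maximalR R f y).toReal‖ₑ ^ p /
              ((‖x - y‖ₑ + ‖R x - R y‖ₑ) ^ (ε + s * p) * ‖x - y‖ₑ ^ ((n : ℝ) - ε)))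
          ≤ ENNReal.ofReal C * fracSobolevSeminorm s p G f ^ p := by
  have hp0 : 0 < p := by linarith
  have hdn : Module.finrank ℝ (EuclideanSpace ℝ (Fin n)) = n := finrank_euclideanSpace_fin
  set A := pointwiseConst (volume : Measure (EuclideanSpace ℝ (Fin n))) p
  set B := majorantConst (volume : Measure (EuclideanSpace ℝ (Fin n))) p ε
  have hA : A ≠ ∞ := pointwiseConst_ne_top _ hp
  have hB : B ≠ ∞ := majorantConst_ne_top _ hp hε0 hε1 (by rwa [hdn])
  -- Adding `1` gives positivity without inspecting `A` and `B`.
  refine ⟨(A * B).toReal + 1, by positivity, ?_⟩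
  intro s hs0 hs1 G hG _ R hR f hf
  have hθ : 0 < s * p := mul_pos hs0 hp0
  have hθp : s * p ≤ p := by nlinarith
  have hGm := hG.measurableSet
  -- A Borel representative extended by zero: the maximal theorem on the whole space applies to it,
  -- while balls inside `G` do not see the extension.
  set g := G.indicator (hf.aestronglyMeasurable.mk f)
  have hg : Measurable g := hf.aestronglyMeasurable.stronglyMeasurable_mk.measurable.indicator hGm
  have hfg : ∀ᵐ x ∂(volume.restrict G), f x = g x := by
    filter_upwards [hf.aestronglyMeasurable.ae_eq_mk, ae_restrict_mem hGm] with x hx hxG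
    rw [hx]
    exact (indicator_of_mem hxG _).symm
  have hgp : ∫⁻ x, ‖g x‖ₑ ^ p < ∞ := by
    have h := lintegral_rpow_enorm_lt_top_of_eLpNorm_lt_top
      (ENNReal.ofReal_pos.2 hp0).ne' ENNReal.ofReal_ne_top hf.eLpNorm_lt_top
    rw [ENNReal.toReal_ofReal hp0.le] at h
    have h' : ∫⁻ x, ‖g x‖ₑ ^ p = ∫⁻ x in G, ‖f x‖ₑ ^ p := by
      calc ∫⁻ x, ‖g x‖ₑ ^ p = ∫⁻ x in G, ‖g x‖ₑ ^ p := by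
            rw [← lintegral_indicator hGm]
            refine lintegral_congr fun x => ?_
            by_cases hx : x ∈ G <;> simp [g, hx, hp0]
        _ = _ := lintegral_congr_ae (by filter_upwards [hfg] with x hx; rw [hx])
    rwa [h']
  have hM : ∀ᵐ x ∂(volume.restrict G), maximalR R f x = maximalR R g x := by
    filter_upwards [hfg, ae_restrict_mem hGm] with x hx hxG
    exact maximalR_congr hR hG hfg hxG hx
  have hMfin : ∀ᵐ x ∂(volume.restrict G), maximalR R g x < ∞ :=
    ae_restrict_of_ae (maximalR_ae_lt_top hp hg hgp)
  have hsemi : fracSobolevSeminorm s p G f ^ p =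
      ∫⁻ x in G, ∫⁻ y in G, ‖g x - g y‖ₑ ^ p / ‖x - y‖ₑ ^ ((n : ℝ) + s * p) := by
    rw [fracSobolevSeminorm, ← ENNReal.rpow_mul, one_div_mul_cancel hp0.ne', ENNReal.rpow_one]
    refine lintegral_congr_ae ?_
    filter_upwards [hfg] with x hx
    refine lintegral_congr_ae ?_
    filter_upwards [hfg] with y hy
    rw [hx, hy]
  refine ⟨(aemeasurable_maximalR hR hGm hg).congr (hM.mono fun x hx => hx.symm), ?_, ?_⟩
  · filter_upwards [hM, hMfin] with x hx hx'
    rwa [hx]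
  calc _ ≤ ∫⁻ x in G, ∫⁻ y in G, A * majorant volume G g p (s * p) ε x y := by
        refine lintegral_mono_ae ?_
        filter_upwards [hM, hMfin, ae_restrict_mem hGm] with x hx hx' hxG
        refine lintegral_mono_ae ?_
        filter_upwards [hM, hMfin, ae_restrict_mem hGm] with y hy hy' hyG
        rw [hx, hy]
        exact maximalR_diffQuotient_le hp hθ hθp hε0 hε1 hR hG hg hxG hyG hx' hy'
    _ = A * ∫⁻ x in G, ∫⁻ y in G, majorant volume G g p (s * p) ε x y := by
        simp_rw [lintegral_const_mul' A _ hA]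
    _ ≤ A * ∫⁻ x, ∫⁻ y, majorant volume G g p (s * p) ε x y := by
        gcongr
        · exact Measure.restrict_le_self
        · exact Measure.restrict_le_self
    _ ≤ A * (B * ∫⁻ x in G, ∫⁻ y in G,
          ‖g x - g y‖ₑ ^ p / ‖x - y‖ₑ ^ ((n : ℝ) + s * p)) := by
        have h := lintegral_majorant_le (volume : Measure (EuclideanSpace ℝ (Fin n))) hp hθ hθp
          hε0 hε1 (by rwa [hdn]) hGm hg
        rw [hdn] at h
        gcongr
    _ ≤ _ := by
        rw [hsemi, ← mul_assoc]
        gcongr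
        rw [ENNReal.le_ofReal_iff_toReal_le (ENNReal.mul_ne_top hA hB) (by positivity)]
        linarith
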